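/- Let $\mathcal G$ be a connected (possibly infinite) graph with uniformly bounded degrees, e.g. a regular lattice, with graph distance $d$, and attach a $q$-level system to each vertex. A (possibly time-dependent) local Hamiltonian on a finite set of vertices is a finite sum of Hermitian terms, continuous in the parameter, each with support of diameter at most $R$ and norm at most $J$, each vertex lying in the support of at most $M$ terms; here the support of a parameter-dependent term is the union of the supports of its values. There are positive constants $c_0,\gamma,\nu$ depending only on $\mathcal G,R,M,J$ (in particular not on $q$ or on the finite set of vertices) for which the Lieb–Robinson bound holds: if $U(t)$ is the unitary evolution generated by such a Hamiltonian and $O_A,O_B$ are supported on regions $A,B$ at distance $L$, then $$\|[U(t)O_AU(t)^\dagger,O_B]\|\le c_0\min(|A|,|B|)\,\|O_A\|\,\|O_B\|\,e^{\gamma t-\nu L}\qquad(t\ge 0).$$ Moreover, for all constants $C,K$ there is $c\ge c_0$ (so that the bound also holds with $c$ in place of $c_0$), depending only on these data, such that the following holds. Let $\tilde G(s)=\sum_{\mu\in\Upsilon}G_\mu(s)$, $s\in[0,1]$, be a differentiable path of such local Hamiltonians with $|\Upsilon|\le CN$ terms, $N\ge1$, which is frustration-free: for every $s$ all $G_\mu(s)$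 are positive semidefinite and have a common nonzero kernel vector. Let $D$ be a set of at most $K$ sites that contains $\operatorname{supp}\frac{\mathrm d}{\mathrm ds}\tilde G$ and meets the support of every term $G_\mu$ that is not constant in $s$ (one takes $D=\operatorname{supp}\frac{\mathrm d}{\mathrm ds}\tilde G$ when no non-constant term is supported away from that set). For $\chi,\tau>0$ let $$G(s)=\sum_{\mu\in\Upsilon'}G_\mu(s),\qquad \Upsilon'=\{\mu\in\Upsilon\mid d(D,\operatorname{supp}G_\mu)<\chi\tau\},$$ and let $\psi,\tilde\psi$ solve $i\frac{\mathrm d}{\mathrm dt}\psi(t)=G(t/\tau)\psi(t)$ and $i\frac{\mathrm d}{\mathrm dt}\tilde\psi(t)=\tilde G(t/\tau)\tilde\psi(t)$ on $[0,\tau]$ with $\psi(0)=\tilde\psi(0)=\phi(0)$, a normalised ground state of $\tilde G(0)$. (i) There is $\chi_0$, depending only on $\mathcal G,R,M,J,C,K$, such that for all $\chi\ge\chi_0$, all $N\geq 1$, all $\tau>0$ and all such paths $$\|\tilde\psi(\tau)-\psi(\tau)\|\le c\,N^2\tau^2e^{(\gamma-\nu\chi/2)\tau}.$$ (ii) In particular,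 let $\alpha\ge0$ and $a>0$. There is $\chi_0$, depending only on $\mathcal G,R,M,J,C,K,\alpha,a$, such that for all $\chi\ge\chi_0$, all $N\ge1$, $0<\varepsilon\le1$, all $\tau>0$ with $\tau\ge a\log^{1+\alpha}(N/\varepsilon)$ (such as a runtime of order $\log^{1+\alpha}(N/\varepsilon)$), and all such paths $$\|\tilde\psi(\tau)-\psi(\tau)\|\le\varepsilon/N.$$ -/

import Mathlib

namespace SpinLattice

/-- Pure states of a finite collection `S` of `q`-level systems, `⨂_{v ∈ S} ℂ^q`,
written in the product basis, which is indexed by the configurations `S → Fin q`. -/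
abbrev State (S : Type*) [Fintype S] [DecidableEq S] (q : ℕ) := EuclideanSpace ℂ (S → Fin q)

/-- Operators on `⨂_{v ∈ S} ℂ^q`, with the operator norm. -/
abbrev Op (S : Type*) [Fintype S] [DecidableEq S] (q : ℕ) := State S q →L[ℂ] State S q

section Support

variable {S : Type*} [Fintype S] [DecidableEq S] {q : ℕ}

/-- `A = B ⊗ 1` with `B` acting on the sites of `X` and `1` the identity on all other sites,
expressed through the matrix entries of `A` in the product basis. -/
def SupportedOn (A : Op S q) (X : Finset S) : Prop :=
  ∃ B : Matrix (X → Fin q) (X → Fin q) ℂ, ∀ σ η : S → Fin q,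
    A (EuclideanSpace.single η (1 : ℂ)) σ =
      if ∀ v, v ∉ X → σ v = η v then B (fun v => σ v) (fun v => η v) else 0

open Classical in
/-- The support of an operator: the smallest set of sites on which it is supported. -/
noncomputable def supp (A : Op S q) : Finset S :=
  Finset.univ.filter fun v => ∀ X : Finset S, SupportedOn A X → v ∈ X

open Classical in
/-- The support of an operator-valued function of a real parameter in `I`:
the union of the supports of its values. -/
noncomputable def pathSupp (I : Set ℝ) (F : ℝ → Op S q) : Finset S :=
  Finset.univ.filter fun v => ∃ s ∈ I, v ∈ supp (F s)

end Support

/-- The sum of all the terms of a Hamiltonian. -/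
noncomputable def total {S : Type*} [Fintype S] [DecidableEq S] {q : ℕ} {ι : Type} [Fintype ι]
    (H : ι → ℝ → Op S q) (s : ℝ) : Op S q :=
  ∑ i, H i s

open Classical in
/-- A (parameter-dependent) local Hamiltonian `∑ i, H i t`, `t ∈ I`, on a finite set `Λ` of
vertices of the graph `𝒢`: the terms are Hermitian and continuous in the parameter, each has a
support of diameter at most `R`, each vertex is in the support of at most `M` terms, and the
terms have norm at most `J`. -/
structure IsLocalHamiltonian {V : Type*} [DecidableEq V] (𝒢 : SimpleGraph V) (R M : ℕ) (J : ℝ)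
    (I : Set ℝ) {q : ℕ} {Λ : Finset V} {ι : Type} [Fintype ι] (H : ι → ℝ → Op Λ q) : Prop where
  selfAdjoint : ∀ i, ∀ t ∈ I, IsSelfAdjoint (H i t)
  continuousOn : ∀ i, ContinuousOn (H i) I
  range_le : ∀ i, ∀ x ∈ pathSupp I (H i), ∀ y ∈ pathSupp I (H i), 𝒢.dist (x : V) (y : V) ≤ R
  overlap_le : ∀ x : Λ, (Finset.univ.filter fun i => x ∈ pathSupp I (H i)).card ≤ M
  norm_le : ∀ i, ∀ t ∈ I, ‖H i t‖ ≤ J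

/-- `U t`, `t ∈ [0, T]`, is the unitary evolution from time `0` to time `t` that is generated
by the time-dependent Hamiltonian `H`, i.e. `i dU/dt = H(t) U(t)` and `U(0) = 1`. -/
def IsEvolution {S : Type*} [Fintype S] [DecidableEq S] {q : ℕ} (T : ℝ)
    (H U : ℝ → Op S q) : Prop :=
  U 0 = 1 ∧
    ∀ t ∈ Set.Icc 0 T, HasDerivWithinAt U (-Complex.I • (H t * U t)) (Set.Icc 0 T) t

/-- The Lieb-Robinson bound with constants `c, γ, ν`, for all time-dependent local Hamiltonians
with parameters `R, M, J` on finite sets of vertices of `𝒢`. For nonempty regions `A` and `B`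
the best `L` is the distance between `A` and `B`; if one of them is empty, then the right-hand
side is `0`. -/
def LiebRobinsonBound {V : Type*} [DecidableEq V] (𝒢 : SimpleGraph V) (R M : ℕ) (J : ℝ)
    (c γ ν : ℝ) : Prop :=
  ∀ (q : ℕ) (Λ : Finset V) (ι : Type) [Fintype ι] (T : ℝ) (H : ι → ℝ → Op Λ q)
    (U : ℝ → Op Λ q),
    IsLocalHamiltonian 𝒢 R M J (Set.Icc 0 T) H → IsEvolution T (total H) U →
    ∀ (A B : Finset Λ) (OA OB : Op Λ q), SupportedOn OA A → SupportedOn OB B →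
    ∀ t ∈ Set.Icc 0 T, ∀ L : ℝ, (∀ a ∈ A, ∀ b ∈ B, L ≤ (𝒢.dist (a : V) (b : V) : ℝ)) →
      ‖(U t * OA * star (U t)) * OB - OB * (U t * OA * star (U t))‖ ≤
        c * (min A.card B.card : ℕ) * ‖OA‖ * ‖OB‖ * Real.exp (γ * t - ν * L)

/-- The terms `H i s`, `s ∈ [0, 1]`, are positive semidefinite and, for every `s`, they have a
common nonzero kernel vector. Thus the ground state energy of the sum is `0` and its ground
states are the states that minimise every term. -/
def IsFrustrationFree {S : Type*} [Fintype S] [DecidableEq S] {q : ℕ} {ι : Type}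
    (H : ι → ℝ → Op S q) : Prop :=
  ∀ s ∈ Set.Icc (0 : ℝ) 1, (∀ i, (H i s).IsPositive) ∧ ∃ φ : State S q, φ ≠ 0 ∧ ∀ i, H i s φ = 0

/-- `φ` is a normalised ground state of `H`: it minimises the energy. -/
def IsGroundState {S : Type*} [Fintype S] [DecidableEq S] {q : ℕ}
    (H : Op S q) (φ : State S q) : Prop :=
  ‖φ‖ = 1 ∧ ∀ η : State S q, ‖η‖ = 1 →
    (inner ℂ φ (H φ)).re ≤ (inner ℂ η (H η)).re

/-- `ψ` solves `i dψ/dt = H(t/τ) ψ(t)` for `t ∈ [0, τ]` with `ψ(0) = φ`. -/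
def IsAdiabaticEvolution {S : Type*} [Fintype S] [DecidableEq S] {q : ℕ} (τ : ℝ)
    (H : ℝ → Op S q) (φ : State S q) (ψ : ℝ → State S q) : Prop :=
  ψ 0 = φ ∧
    ∀ t ∈ Set.Icc 0 τ, HasDerivWithinAt ψ (-Complex.I • H (t / τ) (ψ t)) (Set.Icc 0 τ) t

/-- The support of `d/ds ∑ i, H i s` on `[0, 1]`. -/
noncomputable def derivSupp {S : Type*} [Fintype S] [DecidableEq S] {q : ℕ} {ι : Type}
    [Fintype ι] (H : ι → ℝ → Op S q) : Finset S :=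
  pathSupp (Set.Icc 0 1) fun s => derivWithin (total H) (Set.Icc 0 1) s

open Classical in
/-- The sum of the terms whose support is at distance less than `r` from `D`. -/
noncomputable def truncation {V : Type*} [DecidableEq V] (𝒢 : SimpleGraph V) {q : ℕ}
    {Λ : Finset V} {ι : Type} [Fintype ι] (H : ι → ℝ → Op Λ q) (D : Finset Λ) (r : ℝ)
    (s : ℝ) : Op Λ q :=
  ∑ i ∈ Finset.univ.filter (fun i => ∃ x ∈ D, ∃ y ∈ pathSupp (Set.Icc 0 1) (H i),
    (𝒢.dist (x : V) (y : V) : ℝ) < r), H i s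

/-- A differentiable, frustration-free path `G` of local Hamiltonians on `[0, 1]`, together with
a set `D` of sites where it changes: `D` contains the support of the derivative of the sum of
the terms, and the terms whose support does not meet `D` are constant. -/
structure IsLocallyChangingPath {V : Type*} [DecidableEq V] (𝒢 : SimpleGraph V) (R M : ℕ) (J : ℝ)
    {q : ℕ} {Λ : Finset V} {ι : Type} [Fintype ι] (G : ι → ℝ → Op Λ q) (D : Finset Λ) :
    Prop where
  isLocal : IsLocalHamiltonian 𝒢 R M J (Set.Icc 0 1) G
  differentiableOn : ∀ i, DifferentiableOn ℝ (G i) (Set.Icc 0 1)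
  frustrationFree : IsFrustrationFree G
  derivSupp_subset : derivSupp G ⊆ D
  eq_of_disjoint : ∀ i, Disjoint (pathSupp (Set.Icc 0 1) (G i)) D →
    ∀ s ∈ Set.Icc (0 : ℝ) 1, G i s = G i 0

end SpinLattice

/-!
The Lieb-Robinson bound. Let `X t = U t P (U t)*`, and let `O` be supported on `Y`. Split the
Hamiltonian into the terms that meet `Y`, with sum `C t`, and the others, with sum `B t`. As `B t`
commutes with `O`, the commutator `[X, O]` satisfies a Heisenberg equation with generator `B t` and
source `-i [[C, X], O]` (`norm_commutator_le_of_hasDerivWithinAt`). Heisenberg equations with a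
Hermitian generator preserve the operator norm, so `‖[X, O]‖` grows at most by the integral of
`2 ‖O‖ ∑ ‖[X, h]‖` over the terms `h` that meet `Y`. With `O` one of the terms, this is a closed
system of inequalities for the norms `‖[X t, h t]‖`. If they are bounded by `S e^{γt - f}`, where `f`
is the distance to the support of `P`, the inequalities improve the constant to `a + S / 2`, since
only boundedly many terms meet a given one; hence `S = 2a` is a bound too
(`IsLocalHamiltonian.norm_commutator_term_le`). The constants do not see the local dimension or the
number of sites. The estimate comes with the factor `|B|`; the one with `|A|` follows by time
reversal.

The truncation error. Let `G₀` be the truncated Hamiltonian at `s = 0` and `W s = G̃ s - G̃ 0`, which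
is supported on `D` because the derivative of `G̃` is, and which is also the change of the truncated
Hamiltonian because only constant terms are dropped. By Duhamel's formula it suffices to bound
`‖h ψ(t)‖` for each dropped term `h`. The initial state is annihilated by `h` and, by
frustration-freeness, by `G₀`, so it is stationary for `G₀`. Hence `h ψ(t)` only arises from
commutators of `h` with the perturbation `W` evolved for a time at most `τ` under the static local
Hamiltonian `G₀` (`norm_apply_le_of_commutator_le`), and these commutators are exponentially small by
the Lieb-Robinson bound, as `h` is at distance at least `χτ` from `D`. The two time integrals give the
factor `τ²`. No spectral gap and no slow variation is used.

For the error `ε / N`, the lower bound on the runtime turns powers of `N / ε` into exponentials in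
`τ`, which a large `χ` absorbs (`exists_rate_le`).
-/

namespace SpinLattice

open Set Filter Topology

/-! ### Growth of solutions of Schrödinger and Heisenberg equations -/

/-- If `f' = w + g` and a step along `w` does not increase the norm of `f` to first order, then `‖f‖`
grows no faster than the integral `β` of a bound on `‖g‖`. -/
theorem norm_le_of_hasDerivWithinAt_add {E : Type*} [NormedAddCommGroup E] [NormedSpace ℝ E]
    {f w g : ℝ → E} {β β' : ℝ → ℝ} {T : ℝ}
    (hf : ∀ t ∈ Icc 0 T, HasDerivWithinAt f (w t + g t) (Icc 0 T) t)
    (hw : ∀ t ∈ Icc 0 T, ∃ k : ℝ, ∀ h : ℝ, 0 < h → ‖f t + h • w t‖ ≤ ‖f t‖ + k * h ^ 2)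
    (hg : ∀ t ∈ Icc 0 T, ‖g t‖ ≤ β' t) (hβ : ∀ t, HasDerivAt β (β' t) t) :
    ∀ t ∈ Icc 0 T, ‖f t‖ ≤ ‖f 0‖ + (β t - β 0) := by
  refine image_le_of_liminf_slope_right_le_deriv_boundary
    (f := fun t => ‖f t‖) (B := fun t => ‖f 0‖ + (β t - β 0)) (B' := β') ?_ ?_ ?_ ?_ ?_
  · exact fun t ht => (hf t ht).continuousWithinAt.norm
  · simp
  · exact fun t _ => (((hβ t).continuousAt.sub continuousAt_const).const_add
      ‖f 0‖).continuousWithinAt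
  · exact fun t _ => (((hβ t).sub_const _).const_add _).hasDerivWithinAt
  · intro x hx r hr
    have hxI := Ico_subset_Icc_self hx
    obtain ⟨k, hk⟩ := hw x hxI
    have hgr : ‖g x‖ < r := (hg x hxI).trans_lt hr
    set e := (r - ‖g x‖) / 3 with he
    have hepos : 0 < e := by rw [he]; linarith
    have hd : HasDerivWithinAt f (w x + g x) (Ioi x) x :=
      (hf x hxI).mono_of_mem_nhdsWithin (Icc_mem_nhdsGT_of_mem hx)
    have h1 := hd.isLittleO.def hepos
    have h2 : ∀ᶠ z in 𝓝[>] x, k * (z - x) < e := by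
      have : Tendsto (fun z => k * (z - x)) (𝓝[>] x) (𝓝 (k * (x - x))) :=
        Continuous.continuousWithinAt (by fun_prop)
      rw [sub_self, mul_zero] at this
      exact this.eventually_lt_const hepos
    refine Eventually.frequently ?_
    filter_upwards [h1, h2, self_mem_nhdsWithin] with z hz1 hz2 hz3
    have hpos : 0 < z - x := sub_pos.2 hz3
    rw [slope_def_field, div_lt_iff₀ hpos]
    have e1 : f z = (f z - f x - (z - x) • (w x + g x)) + (f x + (z - x) • w x)
        + (z - x) • g x := by
      rw [smul_add]; abel
    have e2 := norm_add₃_le (a := f z - f x - (z - x) • (w x + g x))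
      (b := f x + (z - x) • w x) (c := (z - x) • g x)
    rw [← e1, norm_smul, Real.norm_of_nonneg hpos.le] at e2
    rw [Real.norm_of_nonneg hpos.le] at hz1
    have e3 := hk _ hpos
    have e4 : k * (z - x) ^ 2 ≤ e * (z - x) := by nlinarith
    have e5 : r = 3 * e + ‖g x‖ := by rw [he]; ring
    rw [e5]
    nlinarith

variable {F : Type*} [NormedAddCommGroup F] [InnerProductSpace ℂ F] [CompleteSpace F]

/-- The Euler step of a skew-adjoint generator is an isometry up to second order. -/
theorem sq_norm_one_sub_le_of_skewAdjoint {Z : F →L[ℂ] F} (hZ : star Z = -Z) :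
    ‖1 - Z‖ ^ 2 ≤ 1 + ‖Z‖ ^ 2 := by
  have e : star (1 - Z) * (1 - Z) = 1 - Z * Z := by
    rw [star_sub, star_one, hZ]; noncomm_ring
  have h1 : ‖1 - Z * Z‖ ≤ 1 + ‖Z‖ ^ 2 := by
    rw [pow_two]
    exact (norm_sub_le _ _).trans (add_le_add ContinuousLinearMap.norm_id_le (norm_mul_le _ _))
  rwa [← e, CStarRing.norm_star_mul_self, ← pow_two] at h1

theorem star_smul_I_smul {K : F →L[ℂ] F} (hK : IsSelfAdjoint K) (h : ℝ) :
    star (h • (Complex.I • K)) = -(h • (Complex.I • K)) := by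
  simp [star_smul, hK.star_eq]

theorem norm_smul_I_smul (K : F →L[ℂ] F) (h : ℝ) :
    ‖h • (Complex.I • K)‖ ^ 2 = ‖K‖ ^ 2 * h ^ 2 := by
  rw [norm_smul, norm_smul, Complex.norm_I, one_mul, mul_pow, Real.norm_eq_abs, sq_abs, mul_comm]

/-- A Schrödinger equation with a Hermitian generator and a source `g`: the norm of the solution only
grows through the source. -/
theorem norm_le_of_schrodinger {A : ℝ → F →L[ℂ] F} {f g : ℝ → F} {β β' : ℝ → ℝ} {T : ℝ}
    (hA : ∀ t ∈ Icc 0 T, IsSelfAdjoint (A t))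
    (hf : ∀ t ∈ Icc 0 T, HasDerivWithinAt f (-Complex.I • A t (f t) + g t) (Icc 0 T) t)
    (hg : ∀ t ∈ Icc 0 T, ‖g t‖ ≤ β' t) (hβ : ∀ t, HasDerivAt β (β' t) t) :
    ∀ t ∈ Icc 0 T, ‖f t‖ ≤ ‖f 0‖ + (β t - β 0) := by
  refine norm_le_of_hasDerivWithinAt_add hf (fun t ht => ?_) hg hβ
  refine ⟨‖A t‖ ^ 2 * ‖f t‖, fun h _ => ?_⟩
  have e : f t + h • (-Complex.I • A t (f t)) = (1 - h • (Complex.I • A t)) (f t) := by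
    simp [sub_eq_add_neg]
  rw [e]
  refine (ContinuousLinearMap.le_opNorm _ _).trans ?_
  have h1 := sq_norm_one_sub_le_of_skewAdjoint (star_smul_I_smul (hA t ht) h)
  rw [norm_smul_I_smul] at h1
  have h2 : ‖(1 : F →L[ℂ] F) - h • (Complex.I • A t)‖ ≤ 1 + ‖A t‖ ^ 2 * h ^ 2 := by
    nlinarith [mul_nonneg (sq_nonneg ‖A t‖) (sq_nonneg h)]
  have := mul_le_mul_of_nonneg_right h2 (norm_nonneg (f t))
  linarith

/-- A Heisenberg equation with a Hermitian generator and a source `g`: the operator norm of the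
solution only grows through the source. No unitary propagator of `K` is needed. -/
theorem norm_le_of_heisenberg {K X g : ℝ → F →L[ℂ] F} {β β' : ℝ → ℝ} {T : ℝ}
    (hK : ∀ t ∈ Icc 0 T, IsSelfAdjoint (K t))
    (hX : ∀ t ∈ Icc 0 T,
      HasDerivWithinAt X (-Complex.I • (K t * X t - X t * K t) + g t) (Icc 0 T) t)
    (hg : ∀ t ∈ Icc 0 T, ‖g t‖ ≤ β' t) (hβ : ∀ t, HasDerivAt β (β' t) t) :
    ∀ t ∈ Icc 0 T, ‖X t‖ ≤ ‖X 0‖ + (β t - β 0) := by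
  refine norm_le_of_hasDerivWithinAt_add hX (fun t ht => ?_) hg hβ
  refine ⟨2 * ‖K t‖ ^ 2 * ‖X t‖, fun h _ => ?_⟩
  set Z := h • (Complex.I • K t) with hZ
  have hs : star Z = -Z := star_smul_I_smul (hK t ht) h
  have hn : ‖Z‖ ^ 2 = ‖K t‖ ^ 2 * h ^ 2 := norm_smul_I_smul (K t) h
  have e : X t + h • (-Complex.I • (K t * X t - X t * K t))
      = (1 - Z) * X t * (1 - -Z) + Z * X t * Z := by
    have : h • (-Complex.I • (K t * X t - X t * K t)) = -(Z * X t - X t * Z) := by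
      rw [hZ]
      simp only [smul_mul_assoc, mul_smul_comm, smul_sub, neg_smul, smul_neg]
      abel
    rw [this]; noncomm_ring
  have h1 := sq_norm_one_sub_le_of_skewAdjoint hs
  have h2 : ‖1 - -Z‖ ^ 2 ≤ 1 + ‖Z‖ ^ 2 := by
    simpa using sq_norm_one_sub_le_of_skewAdjoint (Z := -Z) (by rw [star_neg, hs])
  have h3 : ‖1 - Z‖ * ‖1 - -Z‖ ≤ 1 + ‖Z‖ ^ 2 := by nlinarith [sq_nonneg (‖1 - Z‖ - ‖1 - -Z‖)]
  calc _ ≤ ‖1 - Z‖ * ‖X t‖ * ‖1 - -Z‖ + ‖Z‖ * ‖X t‖ * ‖Z‖ := by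
        rw [e]
        exact (norm_add_le _ _).trans (add_le_add (norm_mul₃_le ..) (norm_mul₃_le ..))
    _ = (‖1 - Z‖ * ‖1 - -Z‖) * ‖X t‖ + ‖Z‖ ^ 2 * ‖X t‖ := by ring
    _ ≤ (1 + ‖Z‖ ^ 2) * ‖X t‖ + ‖Z‖ ^ 2 * ‖X t‖ := by gcongr
    _ = _ := by rw [hn]; ring

/-! ### The support of an operator -/

section SupportCalculus

variable {S : Type*} [Fintype S] [DecidableEq S] {q : ℕ}

/-- The matrix entry `⟨σ|A|η⟩` in the product basis. -/
noncomputable def entry (A : Op S q) (σ η : S → Fin q) : ℂ :=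
  A (EuclideanSpace.single η (1 : ℂ)) σ

theorem state_eq_sum (x : State S q) : x = ∑ ζ, x ζ • EuclideanSpace.single ζ (1 : ℂ) := by
  ext σ
  simp [Finset.sum_apply, Pi.single_apply]

theorem op_ext {A B : Op S q} (h : ∀ σ η, entry A σ η = entry B σ η) : A = B := by
  ext x σ
  rw [state_eq_sum x]
  simp only [map_sum, map_smul, WithLp.ofLp_sum, Finset.sum_apply, WithLp.ofLp_smul, Pi.smul_apply]
  exact Finset.sum_congr rfl fun ζ _ => congrArg _ (h σ ζ)

theorem entry_mul (A B : Op S q) (σ η : S → Fin q) :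
    entry (A * B) σ η = ∑ ζ, entry A σ ζ * entry B ζ η := by
  have h := congrArg (fun x => A x σ) (state_eq_sum (B (EuclideanSpace.single η (1 : ℂ))))
  simp only [map_sum, map_smul, WithLp.ofLp_sum, Finset.sum_apply, WithLp.ofLp_smul, Pi.smul_apply,
    smul_eq_mul] at h
  exact h.trans (Finset.sum_congr rfl fun ζ _ => mul_comm _ _)

/-- Taking a matrix entry, as a real-linear functional. -/
noncomputable def entryL (σ η : S → Fin q) : Op S q →L[ℝ] ℂ :=
  LinearMap.toContinuousLinearMap
    { toFun := fun A => entry A σ η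
      map_add' := fun A B => by simp [entry]
      map_smul' := fun c A => by simp [entry] }

@[simp] theorem entryL_apply (σ η : S → Fin q) (A : Op S q) : entryL σ η A = entry A σ η := rfl

/-- `A` acts as the identity on the site `v`. -/
def TrivialAt (A : Op S q) (v : S) : Prop :=
  ∀ σ η : S → Fin q, (σ v ≠ η v → entry A σ η = 0) ∧
    ∀ c, σ v = η v → entry A (Function.update σ v c) (Function.update η v c) = entry A σ η

theorem SupportedOn.trivialAt {A : Op S q} {X : Finset S} (h : SupportedOn A X) {v : S}
    (hv : v ∉ X) : TrivialAt A v := by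
  obtain ⟨B, hB⟩ := h
  intro σ η
  refine ⟨fun hne => ?_, fun c he => ?_⟩
  · rw [entry, hB, if_neg fun h => hne (h v hv)]
  · have hc : ∀ ξ : S → Fin q, (fun w : X => Function.update ξ v c w) = fun w : X => ξ w :=
      fun ξ => funext fun w => Function.update_of_ne (fun h : (w : S) = v => hv (h ▸ w.2)) _ _
    rw [entry, entry, hB, hB, hc, hc]
    refine if_congr (forall₂_congr fun w hw => ?_) rfl rfl
    by_cases hwv : w = v
    · subst hwv; simp [he]
    · simp [hwv]

/-- If `A` acts trivially on `W`, then the matrix entries between configurations that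
agree on `W` do not depend on their values there. -/
theorem entry_piecewise {A : Op S q} {W : Finset S} (h : ∀ v ∈ W, TrivialAt A v)
    (ξ σ η : S → Fin q) (he : ∀ v ∈ W, σ v = η v) :
    entry A (W.piecewise ξ σ) (W.piecewise ξ η) = entry A σ η := by
  induction W using Finset.induction_on with
  | empty => simp
  | insert v W hv ih =>
    rw [Finset.piecewise_insert, Finset.piecewise_insert,
      (h v (Finset.mem_insert_self v W) _ _).2, ih]
    · exact fun w hw => h w (Finset.mem_insert_of_mem hw)
    · exact fun w hw => he w (Finset.mem_insert_of_mem hw)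
    · simpa [hv] using he v (Finset.mem_insert_self v W)

theorem entry_congr {A : Op S q} {X : Finset S} (h : ∀ v ∉ X, TrivialAt A v)
    {σ η σ' η' : S → Fin q} (hσ : ∀ v ∈ X, σ v = σ' v) (hη : ∀ v ∈ X, η v = η' v)
    (he : ∀ v ∉ X, σ v = η v) (he' : ∀ v ∉ X, σ' v = η' v) :
    entry A σ η = entry A σ' η' := by
  rw [← entry_piecewise (W := Xᶜ) (by simpa using h) σ' σ η (by simpa using he)]
  congr 1
  · ext v; by_cases hv : v ∈ X <;> simp [hv, hσ]
  · ext v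
    by_cases hv : v ∈ X
    · simp [hv, hη]
    · simp [hv, he' v hv]

/-- An operator that acts trivially on each site outside `X` is supported on `X`: the operator on the
sites of `X` is read off with an arbitrary fixed configuration outside `X`. -/
theorem supportedOn_of_trivialAt {A : Op S q} {X : Finset S} (h : ∀ v ∉ X, TrivialAt A v) :
    SupportedOn A X := by
  classical
  rcases isEmpty_or_nonempty (S → Fin q) with hE | ⟨⟨ξ⟩⟩
  · exact ⟨0, fun σ => (hE.false σ).elim⟩
  · refine ⟨fun x y => entry A (fun v => if hv : v ∈ X then x ⟨v, hv⟩ else ξ v)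
      (fun v => if hv : v ∈ X then y ⟨v, hv⟩ else ξ v), fun σ η => ?_⟩
    split_ifs with he
    · refine entry_congr h ?_ ?_ he ?_ <;> intro v hv <;> simp [hv]
    · push Not at he
      obtain ⟨v, hv, hne⟩ := he
      exact (h v hv σ η).1 hne

theorem supportedOn_iff_trivialAt {A : Op S q} {X : Finset S} :
    SupportedOn A X ↔ ∀ v ∉ X, TrivialAt A v :=
  ⟨fun h _ hv => h.trivialAt hv, supportedOn_of_trivialAt⟩

theorem mem_supp_iff {A : Op S q} {v : S} : v ∈ supp A ↔ ¬ TrivialAt A v := by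
  simp only [supp, Finset.mem_filter, Finset.mem_univ, true_and]
  refine ⟨fun h ht => ?_, fun h X hX => ?_⟩
  · have := h {v}ᶜ (supportedOn_of_trivialAt fun w hw => by
      have : w = v := by simpa using hw
      exact this ▸ ht)
    simp at this
  · by_contra hv
    exact h (hX.trivialAt hv)

/-- Supports are closed under intersection, so that the smallest one exists. -/
theorem supportedOn_iff_supp_subset {A : Op S q} {X : Finset S} :
    SupportedOn A X ↔ supp A ⊆ X := by
  rw [supportedOn_iff_trivialAt]
  refine forall_congr' fun v => ?_
  rw [mem_supp_iff]
  exact not_imp_comm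

theorem supp_zero : supp (0 : Op S q) = ∅ := by
  ext v
  simp [mem_supp_iff, TrivialAt, entry]

theorem TrivialAt.neg {A : Op S q} {v : S} (h : TrivialAt A v) : TrivialAt (-A) v := by
  have e : ∀ σ η, entry (-A) σ η = -entry A σ η := fun σ η => by simp [entry]
  intro σ η
  simp only [e, neg_eq_zero, neg_inj]
  exact h σ η

theorem supp_neg_subset (A : Op S q) : supp (-A) ⊆ supp A := fun v hv => by
  rw [mem_supp_iff] at hv ⊢
  exact fun h => hv h.neg

/-- Operators with disjoint supports commute. -/
theorem SupportedOn.commute {A B : Op S q} {X Y : Finset S} (hA : SupportedOn A X)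
    (hB : SupportedOn B Y) (hXY : Disjoint X Y) : A * B = B * A := by
  rw [supportedOn_iff_trivialAt] at hA hB
  have hX : ∀ v ∈ X, v ∉ Y := fun v h => Finset.disjoint_left.1 hXY h
  have hY : ∀ v ∈ Y, v ∉ X := fun v h => Finset.disjoint_right.1 hXY h
  -- only one intermediate configuration contributes to an entry of such a product
  have key : ∀ {A B : Op S q} {X Y : Finset S}, (∀ v ∉ X, TrivialAt A v) →
      (∀ v ∉ Y, TrivialAt B v) → (∀ v ∈ X, v ∉ Y) → ∀ σ η : S → Fin q,
      entry (A * B) σ η = entry A σ (X.piecewise η σ) * entry B (X.piecewise η σ) η := by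
    intro A B X Y hA hB hX σ η
    rw [entry_mul]
    refine Finset.sum_eq_single _ (fun ζ _ hζ => ?_) (by simp)
    obtain ⟨v, hv⟩ := Function.ne_iff.1 hζ
    by_cases hvX : v ∈ X
    · rw [(hB v (hX v hvX) ζ η).1 (by simpa [hvX] using hv), mul_zero]
    · rw [(hA v hvX σ ζ).1 (fun h => hv (by simp [hvX, h])), zero_mul]
  refine op_ext fun σ η => ?_
  rw [key hA hB hX, key hB hA hY]
  by_cases he : ∀ v, v ∉ X → v ∉ Y → σ v = η v
  · rw [mul_comm]
    congr 1
    · refine entry_congr hB ?_ ?_ ?_ ?_ <;> intro v hv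
      · simp [hY v hv]
      · simp [hv]
      · by_cases hvX : v ∈ X
        · simp [hvX]
        · simpa [hvX] using he v hvX hv
      · simp [hv]
    · refine entry_congr hA ?_ ?_ ?_ ?_ <;> intro v hv
      · simp [hX v hv]
      · simp [hv]
      · simp [hv]
      · by_cases hvY : v ∈ Y
        · simp [hvY]
        · simpa [hvY] using he v hv hvY
  · push Not at he
    obtain ⟨v, hvX, hvY, hne⟩ := he
    rw [(hB v hvY (X.piecewise η σ) η).1 (by simpa [hvX] using hne), mul_zero,
      (hA v hvX (Y.piecewise η σ) η).1 (by simpa [hvY] using hne), mul_zero]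

/-- Triviality at a site is a family of linear conditions, so it passes from the derivative of a path
to its increments, without any continuity of the derivative. -/
theorem TrivialAt.sub_of_derivWithin {F : ℝ → Op S q} {a b : ℝ} {v : S}
    (hF : DifferentiableOn ℝ F (Icc a b))
    (h : ∀ s ∈ Icc a b, TrivialAt (derivWithin F (Icc a b) s) v) :
    ∀ s ∈ Icc a b, TrivialAt (F s - F a) v := by
  have e : ∀ A B : Op S q, ∀ σ η, entry (A - B) σ η = entry A σ η - entry B σ η :=
    fun A B σ η => by simp [entry]
  -- a functional that vanishes on the derivative vanishes on the increments
  have key : ∀ ℓ : Op S q →L[ℝ] ℂ, (∀ s ∈ Icc a b, ℓ (derivWithin F (Icc a b) s) = 0) →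
      ∀ s ∈ Icc a b, ℓ (F s) = ℓ (F a) := by
    intro ℓ hℓ s hs
    have hd : ∀ t ∈ Icc a b, HasDerivWithinAt (fun t => ℓ (F t)) 0 (Icc a b) t := fun t ht => by
      rw [← hℓ t ht]
      exact ℓ.hasFDerivAt.comp_hasDerivWithinAt t (hF t ht).hasDerivWithinAt
    exact constant_of_has_deriv_right_zero (fun t ht => (hd t ht).continuousWithinAt)
      (fun t ht => (hd t (Ico_subset_Icc_self ht)).mono_of_mem_nhdsWithin
        (Icc_mem_nhdsGE_of_mem ht)) s hs
  intro s hs σ η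
  simp only [e]
  refine ⟨fun hne => ?_, fun c he => ?_⟩
  · rw [sub_eq_zero]
    exact key (entryL σ η) (fun t ht => (h t ht σ η).1 hne) s hs
  · have := key (entryL (Function.update σ v c) (Function.update η v c) - entryL σ η)
      (fun t ht => by simpa using sub_eq_zero.2 ((h t ht σ η).2 c he)) s hs
    simp only [_root_.sub_apply, entryL_apply] at this
    linear_combination this

theorem SupportedOn.sub_of_derivWithin {F : ℝ → Op S q} {a b : ℝ} {X : Finset S}
    (hF : DifferentiableOn ℝ F (Icc a b))
    (h : pathSupp (Icc a b) (derivWithin F (Icc a b)) ⊆ X) :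
    ∀ s ∈ Icc a b, SupportedOn (F s - F a) X := fun s hs =>
  supportedOn_of_trivialAt fun v hv => TrivialAt.sub_of_derivWithin hF (fun t ht => by
    by_contra hn
    exact hv (h (by simpa [pathSupp] using ⟨t, ht, mem_supp_iff.2 hn⟩))) s hs

theorem supportedOn_pathSupp {I : Set ℝ} {F : ℝ → Op S q} {s : ℝ} (hs : s ∈ I) :
    SupportedOn (F s) (pathSupp I F) :=
  supportedOn_iff_supp_subset.2 fun v hv => by simpa [pathSupp] using ⟨s, hs, hv⟩

theorem supportedOn_univ (A : Op S q) : SupportedOn A Finset.univ :=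
  supportedOn_iff_supp_subset.2 (Finset.subset_univ _)

end SupportCalculus

/-! ### Unitarity and commutator growth -/

section Hilbert

variable {F : Type*} [NormedAddCommGroup F] [InnerProductSpace ℂ F] [CompleteSpace F]
  {T : ℝ} {H U : ℝ → F →L[ℂ] F}

theorem hasDerivWithinAt_conj
    (hU : ∀ t ∈ Icc 0 T, HasDerivWithinAt U (-Complex.I • (H t * U t)) (Icc 0 T) t)
    (hH : ∀ t ∈ Icc 0 T, IsSelfAdjoint (H t)) (O : F →L[ℂ] F) : ∀ t ∈ Icc 0 T,
    HasDerivWithinAt (fun t => U t * O * star (U t))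
      (-Complex.I • (H t * (U t * O * star (U t)) - U t * O * star (U t) * H t)) (Icc 0 T) t := by
  intro t ht
  have h := hU t ht
  refine ((h.mul_const O).mul h.star).congr_deriv ?_
  simp only [star_smul, star_mul, (hH t ht).star_eq, smul_mul_assoc, mul_smul_comm, mul_assoc,
    smul_sub, star_neg, Complex.star_def, Complex.conj_I, neg_neg, neg_smul,
    neg_mul]
  abel

theorem mul_star_self_of_hasDerivWithinAt (h0 : U 0 = 1)
    (hU : ∀ t ∈ Icc 0 T, HasDerivWithinAt U (-Complex.I • (H t * U t)) (Icc 0 T) t)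
    (hH : ∀ t ∈ Icc 0 T, IsSelfAdjoint (H t)) : ∀ t ∈ Icc 0 T, U t * star (U t) = 1 := by
  intro t ht
  -- `U U* - 1` solves the homogeneous Heisenberg equation with initial value `0`
  have h := norm_le_of_heisenberg (X := fun t => U t * 1 * star (U t) - 1) (g := fun _ => 0)
    (β := fun _ => 0) (β' := fun _ => 0) hH (fun s hs => by
      refine ((hasDerivWithinAt_conj hU hH 1 s hs).sub_const 1).congr_deriv ?_
      rw [add_zero]
      congr 1
      noncomm_ring) (by simp) (fun t => hasDerivAt_const t 0) t ht
  simpa [h0, sub_eq_zero] using h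

theorem star_mul_self_of_hasDerivWithinAt (h0 : U 0 = 1)
    (hU : ∀ t ∈ Icc 0 T, HasDerivWithinAt U (-Complex.I • (H t * U t)) (Icc 0 T) t)
    (hH : ∀ t ∈ Icc 0 T, IsSelfAdjoint (H t)) : ∀ t ∈ Icc 0 T, star (U t) * U t = 1 := by
  intro t ht
  have hd : ∀ s ∈ Icc 0 T, HasDerivWithinAt (fun s => star (U s) * U s) 0 (Icc 0 T) s := by
    intro s hs
    have h := hU s hs
    refine (h.star.mul h).congr_deriv ?_
    simp only [star_smul, star_mul, (hH s hs).star_eq, smul_mul_assoc, mul_smul_comm, mul_assoc,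
      star_neg, Complex.star_def, Complex.conj_I, neg_neg, neg_smul,
    mul_neg]
    abel
  have := constant_of_has_deriv_right_zero (fun s hs => (hd s hs).continuousWithinAt)
    (fun s hs => (hd s (Ico_subset_Icc_self hs)).mono_of_mem_nhdsWithin
      (Icc_mem_nhdsGE_of_mem hs)) t ht
  simpa [h0] using this

theorem norm_conj_le_of_hasDerivWithinAt (h0 : U 0 = 1)
    (hU : ∀ t ∈ Icc 0 T, HasDerivWithinAt U (-Complex.I • (H t * U t)) (Icc 0 T) t)
    (hH : ∀ t ∈ Icc 0 T, IsSelfAdjoint (H t)) (O : F →L[ℂ] F) :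
    ∀ t ∈ Icc 0 T, ‖U t * O * star (U t)‖ ≤ ‖O‖ := by
  intro t ht
  have h := norm_le_of_heisenberg (X := fun t => U t * O * star (U t)) (g := fun _ => 0)
    (β := fun _ => 0) (β' := fun _ => 0) hH
    (fun s hs => by simpa only [add_zero] using hasDerivWithinAt_conj hU hH O s hs) (by simp)
    (fun t => hasDerivAt_const t 0) t ht
  simpa [h0] using h

theorem hasDerivWithinAt_reverse
    (hU : ∀ t ∈ Icc 0 T, HasDerivWithinAt U (-Complex.I • (H t * U t)) (Icc 0 T) t)
    {t : ℝ} (ht : t ∈ Icc 0 T) : ∀ r ∈ Icc 0 t,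
    HasDerivWithinAt (fun r => U (t - r) * star (U t))
      (-Complex.I • (-H (t - r) * (U (t - r) * star (U t)))) (Icc 0 t) r := by
  intro r hr
  have hm : MapsTo (fun r => t - r) (Icc 0 t) (Icc 0 T) := fun x hx =>
    ⟨by linarith [hx.2], by linarith [hx.1, ht.2]⟩
  have h := (hU (t - r) (hm hr)).scomp r ((hasDerivAt_id r).const_sub t).hasDerivWithinAt hm
  refine (h.mul_const (star (U t))).congr_deriv ?_
  simp [mul_assoc]

theorem isSelfAdjoint_finsetSum {ι : Type*} (s : Finset ι) {A : ι → F →L[ℂ] F}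
    (h : ∀ i ∈ s, IsSelfAdjoint (A i)) : IsSelfAdjoint (∑ i ∈ s, A i) := by
  rw [isSelfAdjoint_iff, star_sum]
  exact Finset.sum_congr rfl h

theorem norm_commutator_le (A B : F →L[ℂ] F) : ‖A * B - B * A‖ ≤ 2 * ‖A‖ * ‖B‖ := by
  have h1 := norm_sub_le (A * B) (B * A)
  have h2 := norm_mul_le A B
  have h3 := norm_mul_le B A
  linarith

/-- If `H = C + B` and `B` commutes with `O`, then the commutator of `O` with an observable `X`
that evolves under `H` can only grow through the commutator of `X` with `C`. -/
theorem norm_commutator_le_of_hasDerivWithinAt {B C X : ℝ → F →L[ℂ] F} {O : F →L[ℂ] F}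
    {β β' : ℝ → ℝ} (hB : ∀ t ∈ Icc 0 T, IsSelfAdjoint (B t))
    (hX : ∀ t ∈ Icc 0 T, HasDerivWithinAt X
      (-Complex.I • ((C t + B t) * X t - X t * (C t + B t))) (Icc 0 T) t)
    (hBO : ∀ t ∈ Icc 0 T, B t * O = O * B t)
    (hβ' : ∀ t ∈ Icc 0 T, 2 * ‖O‖ * ‖X t * C t - C t * X t‖ ≤ β' t)
    (hβ : ∀ t, HasDerivAt β (β' t) t) :
    ∀ t ∈ Icc 0 T, ‖X t * O - O * X t‖ ≤ ‖X 0 * O - O * X 0‖ + (β t - β 0) := by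
  refine norm_le_of_heisenberg (X := fun t => X t * O - O * X t) (K := B)
    -- by the Jacobi identity, as `[B, O] = 0`
    (g := fun s => -Complex.I • ((C s * X s - X s * C s) * O - O * (C s * X s - X s * C s)))
    hB (fun s hs => ?_) (fun s hs => ?_) hβ
  · refine (((hX s hs).mul_const O).sub ((hX s hs).const_mul O)).congr_deriv ?_
    rw [smul_mul_assoc, mul_smul_comm, ← smul_sub, ← smul_add]
    congr 1
    have hc := hBO s hs
    have e1 : X s * (B s * O) = X s * (O * B s) := by rw [hc]
    have e2 : B s * (O * X s) = O * (B s * X s) := by rw [← mul_assoc, hc, mul_assoc]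
    simp only [add_mul, mul_add, sub_mul, mul_sub, mul_assoc, e1, e2]
    abel
  · rw [norm_smul, norm_neg, Complex.norm_I, one_mul]
    refine (norm_commutator_le _ _).trans (le_trans (le_of_eq ?_) (hβ' s hs))
    rw [norm_sub_rev]; ring

end Hilbert

section Evolution

variable {S : Type*} [Fintype S] [DecidableEq S] {q : ℕ} {T : ℝ} {H U : ℝ → Op S q}

/-- Evolving backwards from time `t` is the evolution generated by the reversed Hamiltonian. -/
theorem IsEvolution.reverse (hU : IsEvolution T H U) (hH : ∀ t ∈ Icc 0 T, IsSelfAdjoint (H t))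
    {t : ℝ} (ht : t ∈ Icc 0 T) :
    IsEvolution t (fun r => -H (t - r)) (fun r => U (t - r) * star (U t)) := by
  exact ⟨by simpa using mul_star_self_of_hasDerivWithinAt hU.1 hU.2 hH t ht,
    hasDerivWithinAt_reverse hU.2 ht⟩

end Evolution

/-! ### Terms that meet a region -/

section Touching

variable {S : Type*} [Fintype S] [DecidableEq S] {q : ℕ} {ι : Type} [Fintype ι]

open Classical in
/-- The terms of a Hamiltonian whose support meets `Y`. -/
noncomputable def touching (I : Set ℝ) (H : ι → ℝ → Op S q) (Y : Finset S) : Finset ι :=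
  Finset.univ.filter fun i => ¬ Disjoint (pathSupp I (H i)) Y

theorem mem_touching {I : Set ℝ} {H : ι → ℝ → Op S q} {Y : Finset S} {i : ι} :
    i ∈ touching I H Y ↔ ∃ x ∈ pathSupp I (H i), x ∈ Y := by
  simp [touching, Finset.not_disjoint_iff]

open Classical in
theorem card_touching_le {I : Set ℝ} {H : ι → ℝ → Op S q} {M : ℕ}
    (hM : ∀ x, (Finset.univ.filter fun i => x ∈ pathSupp I (H i)).card ≤ M) (Y : Finset S) :
    (touching I H Y).card ≤ Y.card * M := by
  refine (Finset.card_le_card fun i hi => ?_).trans (Finset.card_biUnion_le_card_mul Y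
    (fun x => Finset.univ.filter fun i => x ∈ pathSupp I (H i)) M fun x _ => hM x)
  obtain ⟨x, hx, hxY⟩ := mem_touching.1 hi
  simpa using ⟨x, hxY, hx⟩

/-- The commutator of an evolved observable with `O` only grows through its commutators with the terms
of the Hamiltonian that meet the support of `O`. -/
theorem IsEvolution.norm_commutator_le_of_touching {T : ℝ} {H : ι → ℝ → Op S q}
    {U : ℝ → Op S q} (hH : ∀ i, ∀ t ∈ Icc 0 T, IsSelfAdjoint (H i t))
    (hU : IsEvolution T (total H) U) (P : Op S q) {O : Op S q} {Y : Finset S}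
    (hO : SupportedOn O Y) {E γ : ℝ} (hE : 0 ≤ E) (hγ : 0 < γ)
    (hb : ∀ s ∈ Icc 0 T, ∑ j ∈ touching (Icc 0 T) H Y,
      ‖U s * P * star (U s) * H j s - H j s * (U s * P * star (U s))‖ ≤ E * Real.exp (γ * s)) :
    ∀ t ∈ Icc 0 T, ‖U t * P * star (U t) * O - O * (U t * P * star (U t))‖ ≤
      ‖P * O - O * P‖ + 2 * ‖O‖ * (E / γ * Real.exp (γ * t)) := by
  classical
  intro t ht
  have hsa : ∀ (F : Finset ι), ∀ s ∈ Icc 0 T, IsSelfAdjoint (∑ j ∈ F, H j s) := fun F s hs =>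
    isSelfAdjoint_finsetSum F fun j _ => hH j s hs
  set F := touching (Icc 0 T) H Y with hF
  have h := norm_commutator_le_of_hasDerivWithinAt (X := fun t => U t * P * star (U t)) (O := O)
    (B := fun s => ∑ j ∈ Fᶜ, H j s) (C := fun s => ∑ j ∈ F, H j s)
    (β := fun s => 2 * ‖O‖ * (E / γ * Real.exp (γ * s)))
    (β' := fun s => 2 * ‖O‖ * (E * Real.exp (γ * s)))
    (hsa _) (fun s hs => ?_) (fun s hs => ?_) (fun s hs => ?_) (fun s => ?_) t ht
  · have h0 : (0 : ℝ) ≤ 2 * ‖O‖ * (E / γ * Real.exp (γ * 0)) := by positivity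
    simp only [hU.1, one_mul, star_one, mul_one] at h
    linarith
  · rw [Finset.sum_add_sum_compl F]
    exact hasDerivWithinAt_conj hU.2 (hsa Finset.univ) P s hs
  · rw [Finset.sum_mul, Finset.mul_sum]
    refine Finset.sum_congr rfl fun j hj => (supportedOn_pathSupp hs).commute hO ?_
    simpa [hF, touching] using hj
  · rw [Finset.sum_mul, Finset.mul_sum, ← Finset.sum_sub_distrib]
    gcongr
    exact (norm_sum_le _ _).trans (hb s hs)
  · have h1 : HasDerivAt (fun s => Real.exp (γ * s)) (Real.exp (γ * s) * (γ * 1)) s :=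
      ((hasDerivAt_id s).const_mul γ).exp
    refine ((h1.const_mul (E / γ)).const_mul (2 * ‖O‖)).congr_deriv ?_
    field_simp

end Touching

/-! ### Balls in a graph of bounded degree -/

section Graph

variable {V : Type*} [DecidableEq V] {𝒢 : SimpleGraph V}

/-- In a graph with degrees at most `Δ`, balls of radius `n` have at most `(Δ + 1) ^ n` elements. -/
theorem card_le_of_dist_le (h𝒢 : 𝒢.Connected) {Δ : ℕ}
    (hΔ : ∀ v, (𝒢.neighborSet v).encard ≤ Δ) (n : ℕ) (x : V) (Z : Finset V)
    (hZ : ∀ y ∈ Z, 𝒢.dist x y ≤ n) : Z.card ≤ (Δ + 1) ^ n := by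
  classical
  induction n generalizing x Z with
  | zero =>
    rw [pow_zero, Finset.card_le_one]
    intro a ha b hb
    rw [← h𝒢.dist_eq_zero_iff.1 (Nat.le_zero.1 (hZ a ha)),
      h𝒢.dist_eq_zero_iff.1 (Nat.le_zero.1 (hZ b hb))]
  | succ n ih =>
    have hfin : (𝒢.neighborSet x).Finite :=
      Set.finite_of_encard_le_coe (hΔ x)
    set N := insert x hfin.toFinset with hN
    have hNc : N.card ≤ Δ + 1 := by
      refine (Finset.card_insert_le _ _).trans (Nat.succ_le_succ ?_)
      have := hΔ x
      rw [hfin.encard_eq_coe_toFinset_card] at this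
      exact_mod_cast this
    have hsub : Z ⊆ N.biUnion fun z => Z.filter fun y => 𝒢.dist z y ≤ n := by
      intro y hy
      obtain ⟨p, hp⟩ := h𝒢.exists_walk_length_eq_dist x y
      simp only [Finset.mem_biUnion, Finset.mem_filter]
      cases p with
      | nil => exact ⟨x, by simp [hN], hy, by simp⟩
      | @cons _ z _ hadj p =>
        refine ⟨z, by simp [hN, hadj], hy, ?_⟩
        have h1 := hZ y hy
        have h2 := SimpleGraph.dist_le p
        rw [SimpleGraph.Walk.length_cons] at hp
        omega
    refine (Finset.card_le_card hsub).trans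
      ((Finset.card_biUnion_le_card_mul _ _ ((Δ + 1) ^ n) fun z _ => ?_).trans ?_)
    · exact ih z _ fun y hy => (Finset.mem_filter.1 hy).2
    · rw [pow_succ']
      exact Nat.mul_le_mul_right _ hNc

end Graph

/-! ### The Lieb-Robinson bound -/

section LiebRobinson

/-- Iterating a bound that improves affinely leads to its fixed point. -/
theorem forall_le_two_mul_of_halving {α : Type*} {v e : α → ℝ} {a S₀ : ℝ} (hS₀ : 0 ≤ S₀)
    (ha : 0 ≤ a) (h₀ : ∀ x, v x ≤ S₀ * e x)
    (h : ∀ S, 0 ≤ S → (∀ x, v x ≤ S * e x) → ∀ x, v x ≤ (a + S / 2) * e x) :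
    ∀ x, v x ≤ 2 * a * e x := by
  have hp : ∀ n : ℕ, (1 / 2 : ℝ) ^ n ≤ 1 := fun n => pow_le_one₀ (by norm_num) (by norm_num)
  have hn : ∀ n : ℕ, ∀ x, v x ≤ (2 * a * (1 - (1 / 2) ^ n) + S₀ * (1 / 2) ^ n) * e x := by
    intro n
    induction n with
    | zero => simpa using h₀
    | succ n ih =>
      intro x
      have h1 := sub_nonneg.2 (hp n)
      refine (h _ (by positivity) ih x).trans (le_of_eq ?_)
      ring
  intro x
  have hlim : Tendsto (fun n : ℕ => (1 / 2 : ℝ) ^ n) atTop (𝓝 0) :=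
    tendsto_pow_atTop_nhds_zero_of_lt_one (by norm_num) (by norm_num)
  have ht : Tendsto (fun n : ℕ => (2 * a * (1 - (1 / 2 : ℝ) ^ n) + S₀ * (1 / 2 : ℝ) ^ n) * e x)
      atTop (𝓝 ((2 * a * (1 - 0) + S₀ * 0) * e x)) :=
    (((hlim.const_sub 1).const_mul _).add (hlim.const_mul _)).mul_const _
  simpa using ge_of_tendsto' ht fun n => hn n x

variable {V : Type*} [DecidableEq V] {𝒢 : SimpleGraph V} {Δ R M : ℕ} {J T : ℝ} {q : ℕ}
  {Λ : Finset V} {ι : Type} [Fintype ι] {H : ι → ℝ → Op Λ q} {U : ℝ → Op Λ q}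

/-- The Lieb-Robinson velocity (for the decay rate `1` in space). -/
noncomputable def lrVelocity (Δ R M : ℕ) (J : ℝ) : ℝ :=
  4 * J * ((Δ + 1) ^ R * M) * Real.exp R + 1

theorem lrVelocity_ge_one (hJ : 0 ≤ J) : 1 ≤ lrVelocity Δ R M J := by
  unfold lrVelocity
  have : 0 ≤ 4 * J * (((Δ : ℝ) + 1) ^ R * M) * Real.exp R := by positivity
  linarith

theorem IsLocalHamiltonian.card_touching_pathSupp_le (h𝒢 : 𝒢.Connected)
    (hΔ : ∀ v, (𝒢.neighborSet v).encard ≤ Δ) {I : Set ℝ} (hH : IsLocalHamiltonian 𝒢 R M J I H)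
    (i : ι) : (touching I H (pathSupp I (H i))).card ≤ (Δ + 1) ^ R * M := by
  refine (card_touching_le hH.overlap_le _).trans (Nat.mul_le_mul_right M ?_)
  rcases (pathSupp I (H i)).eq_empty_or_nonempty with he | ⟨x, hx⟩
  · simp [he]
  · rw [← Finset.card_map (Function.Embedding.subtype _)]
    refine card_le_of_dist_le h𝒢 hΔ R (x : V) _ fun y hy => ?_
    obtain ⟨z, hz, rfl⟩ := Finset.mem_map.1 hy
    exact hH.range_le i x hx z hz

/-- The commutators with the terms of the Hamiltonian decay exponentially with the distance,
which is measured by a `1`-Lipschitz function `f` that is nonpositive on the initial support. -/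
theorem IsLocalHamiltonian.norm_commutator_term_le (h𝒢 : 𝒢.Connected)
    (hΔ : ∀ v, (𝒢.neighborSet v).encard ≤ Δ) (hJ : 0 ≤ J)
    (hH : IsLocalHamiltonian 𝒢 R M J (Icc 0 T) H) (hU : IsEvolution T (total H) U)
    {f : Λ → ℝ} (hf : ∀ x y : Λ, f x ≤ f y + 𝒢.dist (x : V) (y : V))
    {A : Finset Λ} {P : Op Λ q} (hP : SupportedOn P A) (hA : ∀ x ∈ A, f x ≤ 0)
    (i : ι) (x : Λ) (hx : x ∈ pathSupp (Icc 0 T) (H i)) (t : ℝ) (ht : t ∈ Icc 0 T) :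
    ‖U t * P * star (U t) * H i t - H i t * (U t * P * star (U t))‖ ≤
      2 * (2 * J * ‖P‖ * Real.exp R) * Real.exp (lrVelocity Δ R M J * t - f x) := by
  set γ := lrVelocity Δ R M J with hγ
  have hγ1 : 1 ≤ γ := lrVelocity_ge_one hJ
  let α := {p : ι × Λ × ℝ // p.2.1 ∈ pathSupp (Icc 0 T) (H p.1) ∧ p.2.2 ∈ Icc 0 T}
  let v : α → ℝ := fun p => ‖U p.1.2.2 * P * star (U p.1.2.2) * H p.1.1 p.1.2.2
    - H p.1.1 p.1.2.2 * (U p.1.2.2 * P * star (U p.1.2.2))‖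
  let e : α → ℝ := fun p => Real.exp (γ * p.1.2.2 - f p.1.2.1)
  have hsa : ∀ s ∈ Icc 0 T, IsSelfAdjoint (total H s) := fun s hs =>
    isSelfAdjoint_finsetSum _ fun j _ => hH.selfAdjoint j s hs
  -- the crude initial constant depends on `Λ`, but it drops out of the conclusion
  refine forall_le_two_mul_of_halving (v := v) (e := e)
    (S₀ := 2 * ‖P‖ * J * ∑ x : Λ, Real.exp (f x)) ?_ (by positivity) ?_ ?_ ⟨(i, x, t), hx, ht⟩
  · exact mul_nonneg (by positivity) (Finset.sum_nonneg fun _ _ => (Real.exp_pos _).le)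
  · rintro ⟨⟨i, x, t⟩, hx, ht⟩
    have h1 : 1 ≤ (∑ y : Λ, Real.exp (f y)) * Real.exp (γ * t - f x) := by
      have h2 : Real.exp (f x) ≤ ∑ y : Λ, Real.exp (f y) :=
        Finset.single_le_sum (fun y _ => (Real.exp_pos (f y)).le) (Finset.mem_univ x)
      refine le_trans ?_ (mul_le_mul_of_nonneg_right h2 (Real.exp_pos _).le)
      rw [← Real.exp_add]
      refine Real.one_le_exp ?_
      nlinarith [ht.1]
    have h2 := norm_commutator_le (U t * P * star (U t)) (H i t)
    have h3 : 2 * ‖U t * P * star (U t)‖ * ‖H i t‖ ≤ 2 * ‖P‖ * J := by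
      gcongr
      · exact norm_conj_le_of_hasDerivWithinAt hU.1 hU.2 hsa P t ht
      · exact hH.norm_le i t ht
    change ‖U t * P * star (U t) * H i t - H i t * (U t * P * star (U t))‖ ≤
      2 * ‖P‖ * J * (∑ y : Λ, Real.exp (f y)) * Real.exp (γ * t - f x)
    have h4 : 0 ≤ 2 * ‖P‖ * J := by positivity
    nlinarith
  · rintro S hS hv ⟨⟨i, x, t⟩, hx, ht⟩
    replace hv : ∀ j, ∀ y ∈ pathSupp (Icc 0 T) (H j), ∀ s ∈ Icc 0 T,
        ‖U s * P * star (U s) * H j s - H j s * (U s * P * star (U s))‖ ≤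
          S * Real.exp (γ * s - f y) := fun j y hy s hs => hv ⟨(j, y, s), hy, hs⟩
    change ‖U t * P * star (U t) * H i t - H i t * (U t * P * star (U t))‖ ≤
      (2 * J * ‖P‖ * Real.exp R + S / 2) * Real.exp (γ * t - f x)
    have hclose : ∀ y ∈ pathSupp (Icc 0 T) (H i), f x ≤ f y + R := fun y hy =>
      (hf x y).trans (by gcongr; exact hH.range_le i x hx y hy)
    have hmain := hU.norm_commutator_le_of_touching hH.selfAdjoint P
      (supportedOn_pathSupp (F := H i) ht) (E := ((Δ + 1) ^ R * M) * (S * Real.exp (R - f x)))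
      (by positivity) (zero_lt_one.trans_le hγ1) (fun s hs => ?_) t ht
    · refine hmain.trans ?_
      have h1 : ‖P * H i t - H i t * P‖ ≤ 2 * J * ‖P‖ * Real.exp R * Real.exp (γ * t - f x) := by
        by_cases hd : Disjoint A (pathSupp (Icc 0 T) (H i))
        · rw [hP.commute (supportedOn_pathSupp ht) hd, sub_self, norm_zero]
          positivity
        · obtain ⟨y, hyA, hy⟩ := Finset.not_disjoint_iff.1 hd
          rw [mul_assoc, ← Real.exp_add]
          have h2 : 1 ≤ Real.exp (R + (γ * t - f x)) := by
            refine Real.one_le_exp ?_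
            nlinarith [ht.1, hclose y hy, hA y hyA]
          have h3 := norm_commutator_le P (H i t)
          have h4 := mul_le_mul_of_nonneg_left (hH.norm_le i t ht) (norm_nonneg P)
          have h5 : 0 ≤ 2 * J * ‖P‖ := by positivity
          nlinarith
      have h2 : 2 * ‖H i t‖ * (((Δ + 1) ^ R * M) * (S * Real.exp (R - f x)) / γ *
          Real.exp (γ * t)) ≤ S / 2 * Real.exp (γ * t - f x) := by
        have e1 : Real.exp (R - f x) * Real.exp (γ * t)
            = Real.exp R * Real.exp (γ * t - f x) := by
          rw [← Real.exp_add, ← Real.exp_add]; ring_nf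
        have e2 : 2 * J * ((Δ + 1) ^ R * M) * Real.exp R / γ ≤ 1 / 2 := by
          rw [div_le_div_iff₀ (by linarith) two_pos, hγ, lrVelocity]
          linarith
        calc _ ≤ 2 * J * (((Δ + 1) ^ R * M) * (S * Real.exp (R - f x)) / γ *
              Real.exp (γ * t)) := by
              gcongr
              exact hH.norm_le i t ht
          _ = 2 * J * ((Δ + 1) ^ R * M) / γ * S * (Real.exp (R - f x) * Real.exp (γ * t)) := by
              ring
          _ = (2 * J * ((Δ + 1) ^ R * M) * Real.exp R / γ) * S * Real.exp (γ * t - f x) := by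
              rw [e1]; ring
          _ ≤ 1 / 2 * S * Real.exp (γ * t - f x) := by gcongr
          _ = _ := by ring
      linarith
    · have h1 : ∀ j ∈ touching (Icc 0 T) H (pathSupp (Icc 0 T) (H i)),
          ‖U s * P * star (U s) * H j s - H j s * (U s * P * star (U s))‖ ≤
            S * Real.exp (R - f x) * Real.exp (γ * s) := by
        intro j hj
        obtain ⟨y, hy, hyi⟩ := mem_touching.1 hj
        -- `H j` meets the support of `H i`, so `f y` is at most `R` smaller than `f x`
        refine (hv j y hy s hs).trans ?_
        rw [mul_assoc, ← Real.exp_add]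
        gcongr
        linarith [hclose y hyi]
      refine (Finset.sum_le_card_nsmul _ _ _ h1).trans ?_
      rw [nsmul_eq_mul, ← mul_assoc]
      gcongr
      exact_mod_cast hH.card_touching_pathSupp_le h𝒢 hΔ i

/-- A constant for which the Lieb-Robinson bound holds. -/
noncomputable def lrConstant (R M : ℕ) (J : ℝ) : ℝ := 2 + 8 * M * J * Real.exp R

/-- The Lieb-Robinson bound with the number of sites of the second region in front. -/
theorem IsLocalHamiltonian.norm_commutator_le_card (h𝒢 : 𝒢.Connected)
    (hΔ : ∀ v, (𝒢.neighborSet v).encard ≤ Δ) (hJ : 0 ≤ J)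
    (hH : IsLocalHamiltonian 𝒢 R M J (Icc 0 T) H) (hU : IsEvolution T (total H) U)
    {A B : Finset Λ} {P O : Op Λ q} (hP : SupportedOn P A) (hO : SupportedOn O B) {L : ℝ}
    (hL : ∀ a ∈ A, ∀ b ∈ B, L ≤ 𝒢.dist (a : V) (b : V)) (t : ℝ) (ht : t ∈ Icc 0 T) :
    ‖U t * P * star (U t) * O - O * (U t * P * star (U t))‖ ≤
      lrConstant R M J * B.card * ‖P‖ * ‖O‖ * Real.exp (lrVelocity Δ R M J * t - L) := by
  set γ := lrVelocity Δ R M J with hγ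
  have hγ1 : 1 ≤ γ := lrVelocity_ge_one hJ
  have hc : 0 ≤ lrConstant R M J := by unfold lrConstant; positivity
  have hsa : ∀ s ∈ Icc 0 T, IsSelfAdjoint (total H s) := fun s hs =>
    isSelfAdjoint_finsetSum _ fun j _ => hH.selfAdjoint j s hs
  rcases A.eq_empty_or_nonempty with rfl | hA
  · -- a scalar does not evolve
    have e : U t * P * star (U t) = P := by
      rw [(hP.commute (supportedOn_univ (U t)) (by simp)).symm, mul_assoc,
        mul_star_self_of_hasDerivWithinAt hU.1 hU.2 hsa t ht, mul_one]
    rw [e, hP.commute hO (by simp), sub_self, norm_zero]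
    positivity
  · set f : Λ → ℝ := fun x => A.inf' hA fun a => (𝒢.dist (a : V) (x : V) : ℝ) with hfdef
    have hf : ∀ x y : Λ, f x ≤ f y + 𝒢.dist (x : V) (y : V) := by
      intro x y
      obtain ⟨a, ha, he⟩ := A.exists_mem_eq_inf' hA fun a => (𝒢.dist (a : V) (y : V) : ℝ)
      have h1 : f x ≤ 𝒢.dist (a : V) (x : V) := Finset.inf'_le _ ha
      have h2 : (𝒢.dist (a : V) (x : V) : ℝ) ≤ 𝒢.dist (a : V) (y : V) + 𝒢.dist (y : V) (x : V) := by
        exact_mod_cast h𝒢.dist_triangle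
      have h3 : f y = 𝒢.dist (a : V) (y : V) := he
      rw [SimpleGraph.dist_comm (u := (x : V)), h3]
      exact h1.trans h2
    have hfA : ∀ x ∈ A, f x ≤ 0 := fun x hx =>
      (Finset.inf'_le _ hx).trans (by simp)
    have hfB : ∀ x ∈ B, L ≤ f x := fun x hx => Finset.le_inf' _ _ fun a ha => hL a ha x hx
    have hmain := hU.norm_commutator_le_of_touching hH.selfAdjoint P hO
      (E := B.card * M * (2 * (2 * J * ‖P‖ * Real.exp R)) * Real.exp (-L))
      (by positivity) (zero_lt_one.trans_le hγ1) (fun s hs => ?_) t ht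
    · refine hmain.trans ?_
      have h1 : ‖P * O - O * P‖ ≤ 2 * B.card * ‖P‖ * ‖O‖ * Real.exp (γ * t - L) := by
        by_cases hd : Disjoint A B
        · rw [hP.commute hO hd, sub_self, norm_zero]
          positivity
        · obtain ⟨y, hyA, hyB⟩ := Finset.not_disjoint_iff.1 hd
          have h2 : 1 ≤ Real.exp (γ * t - L) := by
            refine Real.one_le_exp ?_
            nlinarith [ht.1, hfB y hyB, hfA y hyA]
          have h3 : (1 : ℝ) ≤ B.card := by exact_mod_cast Finset.card_pos.2 ⟨y, hyB⟩
          calc _ ≤ 2 * 1 * ‖P‖ * ‖O‖ * 1 := by linarith [norm_commutator_le P O]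
            _ ≤ _ := by gcongr
      have h2 : 2 * ‖O‖ * (B.card * M * (2 * (2 * J * ‖P‖ * Real.exp R)) * Real.exp (-L) / γ *
          Real.exp (γ * t)) ≤
          8 * M * J * Real.exp R * B.card * ‖P‖ * ‖O‖ * Real.exp (γ * t - L) := by
        have e1 : Real.exp (γ * t - L) = Real.exp (-L) * Real.exp (γ * t) := by
          rw [← Real.exp_add]; ring_nf
        calc _ ≤ 2 * ‖O‖ * (B.card * M * (2 * (2 * J * ‖P‖ * Real.exp R)) * Real.exp (-L) *
              Real.exp (γ * t)) := by
              gcongr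
              exact div_le_self (by positivity) hγ1
          _ = _ := by rw [e1]; ring
      unfold lrConstant
      linarith
    · have h1 : ∀ j ∈ touching (Icc 0 T) H B,
          ‖U s * P * star (U s) * H j s - H j s * (U s * P * star (U s))‖ ≤
            2 * (2 * J * ‖P‖ * Real.exp R) * (Real.exp (-L) * Real.exp (γ * s)) := by
        intro j hj
        obtain ⟨y, hy, hyB⟩ := mem_touching.1 hj
        refine (hH.norm_commutator_term_le h𝒢 hΔ hJ hU hf hP hfA j y hy s hs).trans ?_
        rw [← Real.exp_add]
        gcongr
        linarith [hfB y hyB]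
      refine (Finset.sum_le_card_nsmul _ _ _ h1).trans ?_
      rw [nsmul_eq_mul]
      have h2 : ((touching (Icc 0 T) H B).card : ℝ) ≤ B.card * M := by
        exact_mod_cast card_touching_le hH.overlap_le B
      calc _ ≤ (B.card * M : ℝ) *
            (2 * (2 * J * ‖P‖ * Real.exp R) * (Real.exp (-L) * Real.exp (γ * s))) := by gcongr
        _ = _ := by ring

theorem pathSupp_reverse_subset {t : ℝ} (ht : t ∈ Icc 0 T) (F : ℝ → Op Λ q) :
    pathSupp (Icc 0 t) (fun r => -F (t - r)) ⊆ pathSupp (Icc 0 T) F := by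
  intro v hv
  simp only [pathSupp, Finset.mem_filter, Finset.mem_univ, true_and] at hv ⊢
  obtain ⟨r, hr, hv⟩ := hv
  exact ⟨t - r, ⟨by linarith [hr.2], by linarith [hr.1, ht.2]⟩, supp_neg_subset _ hv⟩

theorem IsLocalHamiltonian.reverse (hH : IsLocalHamiltonian 𝒢 R M J (Icc 0 T) H) {t : ℝ}
    (ht : t ∈ Icc 0 T) : IsLocalHamiltonian 𝒢 R M J (Icc 0 t) fun i r => -H i (t - r) := by
  have hm : MapsTo (fun r => t - r) (Icc 0 t) (Icc 0 T) := fun x hx =>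
    ⟨by linarith [hx.2], by linarith [hx.1, ht.2]⟩
  refine ⟨fun i r hr => IsSelfAdjoint.neg (R := Op Λ q) (hH.selfAdjoint i _ (hm hr)), fun i => ?_,
    fun i x hx y hy => ?_, fun x => ?_, fun i r hr => ?_⟩
  · exact ((hH.continuousOn i).comp (by fun_prop) hm).neg
  · exact hH.range_le i x (pathSupp_reverse_subset ht _ hx) y (pathSupp_reverse_subset ht _ hy)
  · refine (Finset.card_le_card fun i hi => ?_).trans (hH.overlap_le x)
    simp only [Finset.mem_filter, Finset.mem_univ, true_and] at hi ⊢
    exact pathSupp_reverse_subset ht _ hi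
  · rw [norm_neg]
    exact hH.norm_le i _ (hm hr)

/-- Conjugation by a unitary may be moved from one factor of a commutator to the other. -/
theorem norm_commutator_conj {F : Type*} [NormedAddCommGroup F] [InnerProductSpace ℂ F]
    [CompleteSpace F] {W : F →L[ℂ] F} (h1 : W * star W = 1) (h2 : star W * W = 1)
    (P O : F →L[ℂ] F) :
    ‖W * P * star W * O - O * (W * P * star W)‖ = ‖star W * O * W * P - P * (star W * O * W)‖ := by
  have hW : W ∈ unitary (F →L[ℂ] F) := Unitary.mem_iff.2 ⟨h2, h1⟩
  have e : W * P * star W * O - O * (W * P * star W)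
      = -(W * (star W * O * W * P - P * (star W * O * W)) * star W) := by
    have e1 : W * (star W * O * W * P) * star W = (W * star W) * O * W * P * star W := by
      noncomm_ring
    have e2 : W * (P * (star W * O * W)) * star W = W * P * star W * O * (W * star W) := by
      noncomm_ring
    rw [mul_sub, sub_mul, e1, e2, h1]
    noncomm_ring
  rw [e, norm_neg, CStarRing.norm_mul_mem_unitary _ (Unitary.star_mem hW),
    CStarRing.norm_mem_unitary_mul _ hW]

theorem liebRobinsonBound (h𝒢 : 𝒢.Connected) (hΔ : ∀ v, (𝒢.neighborSet v).encard ≤ Δ)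
    (hJ : 0 ≤ J) :
    LiebRobinsonBound 𝒢 R M J (lrConstant R M J) (lrVelocity Δ R M J) 1 := by
  intro q Λ ι _ T H U hH hU A B P O hP hO t ht L hL
  have hsa : ∀ s ∈ Icc 0 T, IsSelfAdjoint (total H s) := fun s hs =>
    isSelfAdjoint_finsetSum _ fun j _ => hH.selfAdjoint j s hs
  rw [one_mul]
  rcases le_total B.card A.card with h | h
  · rw [min_eq_right h]
    exact hH.norm_commutator_le_card h𝒢 hΔ hJ hU hP hO hL t ht
  · rw [min_eq_left h, norm_commutator_conj (mul_star_self_of_hasDerivWithinAt hU.1 hU.2 hsa t ht)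
      (star_mul_self_of_hasDerivWithinAt hU.1 hU.2 hsa t ht)]
    have hrev := hU.reverse hsa ht
    have e : (fun r => -total H (t - r)) = total fun i r => -H i (t - r) := by
      funext r
      exact (Finset.sum_neg_distrib _).symm
    rw [e] at hrev
    have h1 := (hH.reverse ht).norm_commutator_le_card h𝒢 hΔ hJ hrev hO hP
      (fun b hb a ha => by rw [SimpleGraph.dist_comm]; exact hL a ha b hb) t ⟨ht.1, le_rfl⟩
    simp only [sub_self, hU.1, one_mul, star_star] at h1
    refine h1.trans (le_of_eq ?_)
    ring

end LiebRobinson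

/-! ### Perturbation of a static evolution and of its stationary state -/

section Duhamel

theorem hasDerivWithinAt_op_apply {F : Type*} [NormedAddCommGroup F] [NormedSpace ℂ F]
    {A : ℝ → F →L[ℂ] F} {A' : F →L[ℂ] F} {f : ℝ → F} {f' : F}
    {s : Set ℝ} {t : ℝ} (hA : HasDerivWithinAt A A' s t) (hf : HasDerivWithinAt f f' s t) :
    HasDerivWithinAt (fun t => A t (f t)) (A' (f t) + A t f') s t :=
  ((ContinuousLinearMap.restrictScalarsL ℂ F F ℝ ℝ).hasFDerivAt.comp_hasDerivWithinAt
    t hA).clm_apply hf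

variable {F : Type*} [NormedAddCommGroup F] [InnerProductSpace ℂ F] [CompleteSpace F]

/-- The unitary group `e^{-irG}` of a time-independent Hamiltonian `G`. -/
noncomputable def staticEvolution (G : F →L[ℂ] F) (r : ℝ) : F →L[ℂ] F :=
  NormedSpace.exp (r • (-Complex.I • G))

theorem staticEvolution_zero (G : F →L[ℂ] F) : staticEvolution G 0 = 1 := by
  simp [staticEvolution]

theorem hasDerivAt_staticEvolution (G : F →L[ℂ] F) (r : ℝ) :
    HasDerivAt (staticEvolution G) (-Complex.I • (G * staticEvolution G r)) r := by
  refine (hasDerivAt_exp_smul_const' (-Complex.I • G) r).congr_deriv ?_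
  rw [smul_mul_assoc]
  rfl

theorem hasDerivAt_staticEvolution' (G : F →L[ℂ] F) (r : ℝ) :
    HasDerivAt (staticEvolution G) (-Complex.I • (staticEvolution G r * G)) r := by
  refine (hasDerivAt_exp_smul_const (-Complex.I • G) r).congr_deriv ?_
  rw [mul_smul_comm]
  rfl

theorem staticEvolution_apply_of_ker {G : F →L[ℂ] F} {φ : F} (h : G φ = 0) {t : ℝ} (ht : 0 ≤ t) :
    staticEvolution G t φ = φ := by
  have hd : ∀ s, HasDerivWithinAt (fun s => staticEvolution G s φ) 0 univ s := by
    intro s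
    refine (hasDerivWithinAt_op_apply (hasDerivAt_staticEvolution' G s).hasDerivWithinAt
      (hasDerivWithinAt_const s univ φ)).congr_deriv ?_
    simp [h]
  have := constant_of_has_deriv_right_zero
    (fun s _ => ((hd s).continuousWithinAt.mono (subset_univ _)))
    (fun s _ => (hd s).mono (subset_univ _)) t ⟨ht, le_rfl⟩
  simpa [staticEvolution_zero] using this

/-- If `φ` is annihilated by `G` and by `h`, then the evolution of `φ` under the perturbed
Hamiltonian `G + V t` stays almost in the kernel of `h`, as long as `h` almost commutes with the
perturbation evolved under `G`. Indeed `f s = h e^{-i(t-s)G} ψ(s)` vanishes at `s = 0` and satisfies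
`f' = -i W f - i [h, W] e^{-i(t-s)G} ψ(s)` with the Hermitian operator
`W = e^{-i(t-s)G} V(s) e^{i(t-s)G}`. -/
theorem norm_apply_le_of_commutator_le {G h : F →L[ℂ] F} {V : ℝ → F →L[ℂ] F} {φ : F} {ψ : ℝ → F}
    {τ δ : ℝ} (hG : IsSelfAdjoint G) (hV : ∀ t ∈ Icc 0 τ, IsSelfAdjoint (V t))
    (hφ : ‖φ‖ = 1) (hGφ : G φ = 0) (hhφ : h φ = 0) (hψ0 : ψ 0 = φ)
    (hψ : ∀ t ∈ Icc 0 τ, HasDerivWithinAt ψ (-Complex.I • (G + V t) (ψ t)) (Icc 0 τ) t)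
    (hδ : ∀ r ∈ Icc 0 τ, ∀ s ∈ Icc 0 τ,
      ‖staticEvolution G r * V s * star (staticEvolution G r) * h
        - h * (staticEvolution G r * V s * star (staticEvolution G r))‖ ≤ δ) :
    ∀ t ∈ Icc 0 τ, ‖h (ψ t)‖ ≤ δ * t := by
  intro t ht
  set E := staticEvolution G with hE
  have hsub : Icc 0 t ⊆ Icc 0 τ := Icc_subset_Icc_right ht.2
  have hEd : ∀ r ∈ Icc 0 τ, HasDerivWithinAt E (-Complex.I • (G * E r)) (Icc 0 τ) r :=
    fun r _ => (hasDerivAt_staticEvolution G r).hasDerivWithinAt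
  have hE1 := star_mul_self_of_hasDerivWithinAt (staticEvolution_zero G) hEd (fun _ _ => hG)
  have hm : ∀ s ∈ Icc 0 t, t - s ∈ Icc 0 τ := fun s hs =>
    ⟨by linarith [hs.2], by linarith [hs.1, ht.2]⟩
  have hψn : ∀ s ∈ Icc 0 τ, ‖ψ s‖ ≤ 1 := by
    intro s hs
    have := norm_le_of_schrodinger (A := fun t => G + V t) (f := ψ) (g := fun _ => 0)
      (β := fun _ => 0) (β' := fun _ => 0) (fun t ht => hG.add (hV t ht))
      (fun t ht => by simpa only [add_zero] using hψ t ht) (by simp)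
      (fun t => hasDerivAt_const t 0) s hs
    simpa [hψ0, hφ] using this
  have hEn : ∀ r ∈ Icc 0 τ, ‖E r‖ ≤ 1 := by
    intro r hr
    have h1 : ‖star (E r) * E r‖ ≤ 1 := by
      rw [hE1 r hr]; exact ContinuousLinearMap.norm_id_le
    rw [CStarRing.norm_star_mul_self] at h1
    nlinarith [norm_nonneg (E r)]
  have key := norm_le_of_schrodinger (A := fun s => E (t - s) * V s * star (E (t - s)))
    (f := fun s => h (E (t - s) (ψ s)))
    (g := fun s => -Complex.I • (h * (E (t - s) * V s * star (E (t - s)))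
      - E (t - s) * V s * star (E (t - s)) * h) (E (t - s) (ψ s)))
    (β := fun s => δ * s) (β' := fun _ => δ)
    (fun s hs => (hV s (hsub hs)).conjugate (E (t - s))) (fun s hs => ?_) (fun s hs => ?_)
    (fun s => by simpa using (hasDerivAt_id s).const_mul δ) t ⟨ht.1, le_rfl⟩
  · simpa [hE, staticEvolution_zero, hψ0, staticEvolution_apply_of_ker hGφ ht.1, hhφ] using key
  · have h1 : HasDerivWithinAt (fun s => E (t - s))
        ((-1 : ℝ) • (-Complex.I • (E (t - s) * G))) (Icc 0 t) s :=
      ((hasDerivAt_staticEvolution' G (t - s)).scomp s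
        ((hasDerivAt_id s).const_sub t)).hasDerivWithinAt
    have h2 := hasDerivWithinAt_op_apply (hasDerivWithinAt_const s (Icc 0 t) h)
      (hasDerivWithinAt_op_apply h1 ((hψ s (hsub hs)).mono hsub))
    refine h2.congr_deriv ?_
    have h3 : ∀ x, star (E (t - s)) (E (t - s) x) = x := fun x => by
      have := congrArg (fun A => A x) (hE1 (t - s) (hm s hs))
      simpa using this
    simp [h3, smul_sub]
  · rw [norm_smul, norm_neg, Complex.norm_I, one_mul]
    refine (ContinuousLinearMap.le_opNorm _ _).trans ?_
    rw [norm_sub_rev]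
    have h1 : ‖E (t - s) (ψ s)‖ ≤ 1 := by
      refine (ContinuousLinearMap.le_opNorm _ _).trans ?_
      exact mul_le_one₀ (hEn _ (hm s hs)) (norm_nonneg _) (hψn s (hsub hs))
    have h2 := hδ (t - s) (hm s hs) s (hsub hs)
    exact (mul_le_of_le_one_right (norm_nonneg _) h1).trans h2

/-- Duhamel's bound: two evolutions differ by the integrated effect of the difference of their
Hamiltonians on one of the two solutions. -/
theorem norm_sub_le_of_schrodinger {A B : ℝ → F →L[ℂ] F} {ψ ψ' : ℝ → F} {τ δ : ℝ}
    (hA : ∀ t ∈ Icc 0 τ, IsSelfAdjoint (A t)) (h0 : ψ 0 = ψ' 0)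
    (hψ : ∀ t ∈ Icc 0 τ, HasDerivWithinAt ψ (-Complex.I • B t (ψ t)) (Icc 0 τ) t)
    (hψ' : ∀ t ∈ Icc 0 τ, HasDerivWithinAt ψ' (-Complex.I • A t (ψ' t)) (Icc 0 τ) t)
    (hδ : ∀ t ∈ Icc 0 τ, ‖(A t - B t) (ψ t)‖ ≤ δ) :
    ∀ t ∈ Icc 0 τ, ‖ψ' t - ψ t‖ ≤ δ * t := by
  intro t ht
  have := norm_le_of_schrodinger (A := A) (f := fun t => ψ' t - ψ t)
    (g := fun t => -Complex.I • (A t - B t) (ψ t)) (β := fun s => δ * s) (β' := fun _ => δ) hA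
    (fun s hs => by
      refine ((hψ' s hs).sub (hψ s hs)).congr_deriv ?_
      rw [← smul_add, ← smul_sub]
      congr 1
      simp)
    (fun s hs => by
      rw [norm_smul, norm_neg, Complex.norm_I, one_mul]
      exact hδ s hs)
    (fun s => by simpa using (hasDerivAt_id s).const_mul δ) t ht
  simpa [h0] using this

open ContinuousLinearMap in
theorem apply_eq_zero_of_re_inner_le_zero {G : F →L[ℂ] F} (hG : G.IsPositive) {φ : F}
    (h : (inner ℂ φ (G φ)).re ≤ 0) : G φ = 0 := by
  obtain ⟨b, rfl⟩ := CStarAlgebra.nonneg_iff_eq_star_mul_self.1 ((nonneg_iff_isPositive G).2 hG)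
  rw [mul_apply_eq_comp, star_eq_adjoint, adjoint_inner_right, inner_self_eq_norm_sq_to_K] at h
  have h1 : ‖b φ‖ ^ 2 ≤ 0 := by exact_mod_cast h
  have h2 : b φ = 0 := by
    rw [← norm_le_zero_iff]; nlinarith [norm_nonneg (b φ)]
  simp [h2]

end Duhamel

section GroundState

variable {S : Type*} [Fintype S] [DecidableEq S] {q : ℕ} {ι : Type} [Fintype ι]

/-- The ground states of a frustration-free Hamiltonian are annihilated by every term. -/
theorem IsFrustrationFree.apply_groundState {G : ι → ℝ → Op S q} (hG : IsFrustrationFree G)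
    {s : ℝ} (hs : s ∈ Icc (0 : ℝ) 1) {φ : State S q} (hφ : IsGroundState (total G s) φ) (i : ι) :
    G i s φ = 0 := by
  obtain ⟨hpos, η, hη, hker⟩ := hG s hs
  refine apply_eq_zero_of_re_inner_le_zero (hpos i) ?_
  have h1 := hφ.2 (((‖η‖⁻¹ : ℝ) : ℂ) • η) (by
    rw [norm_smul, Complex.norm_real, norm_inv, norm_norm, inv_mul_cancel₀ (norm_ne_zero_iff.2 hη)])
  have h2 : total G s η = 0 := by
    rw [total, sum_apply]
    exact Finset.sum_eq_zero fun j _ => hker j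
  rw [map_smul, h2, smul_zero, inner_zero_right, Complex.zero_re, total,
    sum_apply, inner_sum, Complex.re_sum] at h1
  refine le_trans ?_ h1
  exact Finset.single_le_sum (f := fun j => (inner ℂ φ (G j s φ)).re)
    (fun j _ => (hpos j).re_inner_nonneg_right φ) (Finset.mem_univ i)

end GroundState

/-! ### Truncation of a locally changing path -/

section Truncation

variable {V : Type*} [DecidableEq V] {𝒢 : SimpleGraph V} {Δ R M : ℕ} {J : ℝ} {q : ℕ}
  {Λ : Finset V} {ι : Type} [Fintype ι] {G : ι → ℝ → Op Λ q} {D : Finset Λ}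

open Classical in
/-- The terms that are kept by `truncation`. -/
noncomputable def near (𝒢 : SimpleGraph V) (G : ι → ℝ → Op Λ q) (D : Finset Λ) (r : ℝ) :
    Finset ι :=
  Finset.univ.filter fun i => ∃ x ∈ D, ∃ y ∈ pathSupp (Icc 0 1) (G i),
    (𝒢.dist (x : V) (y : V) : ℝ) < r

theorem IsLocallyChangingPath.eq_of_notMem_touching
    (hG : IsLocallyChangingPath 𝒢 R M J G D) {i : ι} (hi : i ∉ touching (Icc 0 1) G D) :
    ∀ s ∈ Icc (0 : ℝ) 1, G i s = G i 0 :=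
  hG.eq_of_disjoint i (by simpa [touching] using hi)

theorem touching_subset_near {r : ℝ} (hr : 0 < r) : touching (Icc 0 1) G D ⊆ near 𝒢 G D r := by
  intro i hi
  obtain ⟨x, hx, hxD⟩ := mem_touching.1 hi
  simpa only [near, Finset.mem_filter, Finset.mem_univ, true_and] using
    ⟨x, hxD, x, hx, by simpa using hr⟩

theorem total_sub_truncation (r : ℝ) (s : ℝ) [DecidableEq ι] :
    total G s - truncation 𝒢 G D r s = ∑ i ∈ (near 𝒢 G D r)ᶜ, G i s := by
  rw [total, truncation, ← Finset.sum_add_sum_compl (near 𝒢 G D r)]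
  exact add_sub_cancel_left _ _

/-- Truncation does not affect the change of the Hamiltonian. -/
theorem IsLocallyChangingPath.truncation_eq (hG : IsLocallyChangingPath 𝒢 R M J G D) {r : ℝ}
    (hr : 0 < r) {s : ℝ} (hs : s ∈ Icc (0 : ℝ) 1) :
    truncation 𝒢 G D r s = truncation 𝒢 G D r 0 + (total G s - total G 0) := by
  classical
  have h : total G s - truncation 𝒢 G D r s = total G 0 - truncation 𝒢 G D r 0 := by
    rw [total_sub_truncation, total_sub_truncation]
    refine Finset.sum_congr rfl fun i hi => hG.eq_of_notMem_touching (fun h => ?_) s hs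
    exact Finset.mem_compl.1 hi (touching_subset_near hr h)
  have := congrArg (fun A => total G s - A) h
  simp only [sub_sub_cancel] at this
  rw [this]
  abel

theorem IsLocallyChangingPath.supportedOn_total_sub (hG : IsLocallyChangingPath 𝒢 R M J G D)
    {s : ℝ} (hs : s ∈ Icc (0 : ℝ) 1) : SupportedOn (total G s - total G 0) D :=
  SupportedOn.sub_of_derivWithin
    (DifferentiableOn.fun_sum fun i _ => hG.differentiableOn i) hG.derivSupp_subset s hs

theorem IsLocallyChangingPath.norm_total_sub_le (hG : IsLocallyChangingPath 𝒢 R M J G D)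
    (hJ : 0 ≤ J) {s : ℝ} (hs : s ∈ Icc (0 : ℝ) 1) :
    ‖total G s - total G 0‖ ≤ D.card * M * (2 * J) := by
  have h0 : (0 : ℝ) ∈ Icc (0 : ℝ) 1 := ⟨le_rfl, zero_le_one⟩
  have e : total G s - total G 0 = ∑ i ∈ touching (Icc 0 1) G D, (G i s - G i 0) := by
    rw [total, total, ← Finset.sum_sub_distrib]
    refine (Finset.sum_subset (Finset.subset_univ _) fun i _ hi => ?_).symm
    rw [hG.eq_of_notMem_touching hi s hs, sub_self]
  rw [e]
  refine (norm_sum_le _ _).trans ((Finset.sum_le_card_nsmul _ _ (2 * J) fun i _ => ?_).trans ?_)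
  · linarith [norm_sub_le (G i s) (G i 0), hG.isLocal.norm_le i s hs, hG.isLocal.norm_le i 0 h0]
  · rw [nsmul_eq_mul]
    have : ((touching (Icc 0 1) G D).card : ℝ) ≤ D.card * M := by
      exact_mod_cast card_touching_le hG.isLocal.overlap_le D
    gcongr

open Classical in
/-- The truncated Hamiltonian at the initial parameter, as a constant family of terms. -/
noncomputable def initialTerms (𝒢 : SimpleGraph V) (G : ι → ℝ → Op Λ q) (D : Finset Λ) (r : ℝ) :
    ι → ℝ → Op Λ q :=
  fun i _ => if i ∈ near 𝒢 G D r then G i 0 else 0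

theorem total_initialTerms (r t : ℝ) :
    total (initialTerms 𝒢 G D r) t = truncation 𝒢 G D r 0 := by
  classical
  rw [total, truncation]
  simp only [initialTerms]
  rw [Finset.sum_ite_mem, Finset.univ_inter]
  rfl

theorem pathSupp_initialTerms_subset (I : Set ℝ) (r : ℝ) (i : ι) :
    pathSupp I (initialTerms 𝒢 G D r i) ⊆ pathSupp (Icc 0 1) (G i) := by
  intro v hv
  simp only [pathSupp, Finset.mem_filter, Finset.mem_univ, true_and] at hv ⊢
  obtain ⟨t, -, hv⟩ := hv
  unfold initialTerms at hv
  split_ifs at hv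
  · exact ⟨0, ⟨le_rfl, zero_le_one⟩, hv⟩
  · simp [supp_zero] at hv

theorem IsLocalHamiltonian.initialTerms (hG : IsLocalHamiltonian 𝒢 R M J (Icc 0 1) G)
    (hJ : 0 ≤ J) (I : Set ℝ) (r : ℝ) :
    IsLocalHamiltonian 𝒢 R M J I (initialTerms 𝒢 G D r) := by
  have h0 : (0 : ℝ) ∈ Icc (0 : ℝ) 1 := ⟨le_rfl, zero_le_one⟩
  refine ⟨fun i t _ => ?_, fun i => continuousOn_const, fun i x hx y hy => ?_, fun x => ?_,
    fun i t _ => ?_⟩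
  · unfold SpinLattice.initialTerms
    split_ifs
    · exact hG.selfAdjoint i 0 h0
    · exact IsSelfAdjoint.zero (R := Op Λ q)
  · exact hG.range_le i x (pathSupp_initialTerms_subset I r i hx) y
      (pathSupp_initialTerms_subset I r i hy)
  · refine (Finset.card_le_card fun i hi => ?_).trans (hG.overlap_le x)
    simp only [Finset.mem_filter, Finset.mem_univ, true_and] at hi ⊢
    exact pathSupp_initialTerms_subset I r i hi
  · unfold SpinLattice.initialTerms
    split_ifs
    · exact hG.norm_le i 0 h0
    · simpa using hJ

/-- The truncation error at radius `r`, from any Lieb-Robinson bound. -/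
theorem IsLocallyChangingPath.norm_sub_le {c γ ν : ℝ} (hLR : LiebRobinsonBound 𝒢 R M J c γ ν)
    (hJ : 0 ≤ J) (hc : 0 ≤ c) (hγ : 0 ≤ γ) (hG : IsLocallyChangingPath 𝒢 R M J G D)
    {τ r : ℝ} (hτ : 0 < τ) (hr : 0 < r)
    {φ : State Λ q} {ψ ψ' : ℝ → State Λ q} (hφ : IsGroundState (total G 0) φ)
    (hψ : IsAdiabaticEvolution τ (truncation 𝒢 G D r) φ ψ)
    (hψ' : IsAdiabaticEvolution τ (total G) φ ψ') :
    ‖ψ' τ - ψ τ‖ ≤ Fintype.card ι *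
      (c * D.card * (D.card * M * (2 * J)) * J * Real.exp (γ * τ - ν * r)) * τ ^ 2 := by
  classical
  have h0 : (0 : ℝ) ∈ Icc (0 : ℝ) 1 := ⟨le_rfl, zero_le_one⟩
  have hm : ∀ t ∈ Icc 0 τ, t / τ ∈ Icc (0 : ℝ) 1 := fun t ht =>
    ⟨div_nonneg ht.1 hτ.le, (div_le_one hτ).2 ht.2⟩
  have hsa : ∀ F : Finset ι, ∀ s ∈ Icc (0 : ℝ) 1, IsSelfAdjoint (∑ i ∈ F, G i s) :=
    fun F s hs => isSelfAdjoint_finsetSum F fun i _ => hG.isLocal.selfAdjoint i s hs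
  set δ := c * D.card * (D.card * M * (2 * J)) * J * Real.exp (γ * τ - ν * r) with hδdef
  have hδ0 : 0 ≤ δ := by positivity
  set G₀ := truncation 𝒢 G D r 0 with hG₀
  have hG₀sa : IsSelfAdjoint G₀ := hsa _ 0 h0
  have hker : ∀ i, G i 0 φ = 0 := hG.frustrationFree.apply_groundState h0 hφ
  have hG₀φ : G₀ φ = 0 := by
    rw [hG₀, truncation, sum_apply]
    exact Finset.sum_eq_zero fun i _ => hker i
  have hE : IsEvolution τ (total (initialTerms 𝒢 G D r)) (staticEvolution G₀) :=
    ⟨staticEvolution_zero G₀, fun t _ => by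
      rw [total_initialTerms]
      exact (hasDerivAt_staticEvolution G₀ t).hasDerivWithinAt⟩
  -- a term that is dropped in the truncation is constant and almost annihilates `ψ`
  have hterm : ∀ i ∉ near 𝒢 G D r, ∀ t ∈ Icc 0 τ, ‖G i (t / τ) (ψ t)‖ ≤ δ * τ := by
    intro i hi t ht
    rw [hG.eq_of_notMem_touching (fun h => hi (touching_subset_near hr h)) _ (hm t ht)]
    have hfar : ∀ x ∈ D, ∀ y ∈ pathSupp (Icc 0 1) (G i), r ≤ (𝒢.dist (x : V) (y : V) : ℝ) := by
      intro x hx y hy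
      by_contra hlt
      exact hi (by
        simpa only [near, Finset.mem_filter, Finset.mem_univ, true_and] using
          ⟨x, hx, y, hy, not_le.1 hlt⟩)
    refine (norm_apply_le_of_commutator_le (V := fun t => total G (t / τ) - total G 0) hG₀sa
      (fun s hs => IsSelfAdjoint.sub (R := Op Λ q) (hsa _ _ (hm s hs)) (hsa _ 0 h0)) hφ.1 hG₀φ
      (hker i) hψ.1 (fun s hs => ?_) (fun ρ hρ s hs => ?_) t ht).trans
      (mul_le_mul_of_nonneg_left ht.2 hδ0)
    · rw [← hG.truncation_eq hr (hm s hs)]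
      exact hψ.2 s hs
    · have h1 := hLR q Λ ι τ _ _ (hG.isLocal.initialTerms hJ _ r) hE D
        (pathSupp (Icc 0 1) (G i)) _ (G i 0) (hG.supportedOn_total_sub (hm s hs))
        (supportedOn_pathSupp h0) ρ hρ r hfar
      refine h1.trans ?_
      rw [hδdef]
      have h2 : ((min D.card (pathSupp (Icc 0 1) (G i)).card : ℕ) : ℝ) ≤ D.card := by
        exact_mod_cast min_le_left _ _
      gcongr
      · exact hG.norm_total_sub_le hJ (hm s hs)
      · exact hG.isLocal.norm_le i 0 h0
      · exact hρ.2
  have hsum := norm_sub_le_of_schrodinger (A := fun t => total G (t / τ))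
    (B := fun t => truncation 𝒢 G D r (t / τ)) (δ := Fintype.card ι * (δ * τ))
    (fun t ht => hsa _ _ (hm t ht)) (hψ.1.trans hψ'.1.symm) hψ.2 hψ'.2 (fun t ht => ?_) τ
    ⟨hτ.le, le_rfl⟩
  · refine hsum.trans (le_of_eq ?_)
    ring
  · rw [total_sub_truncation, sum_apply]
    refine (norm_sum_le _ _).trans ((Finset.sum_le_card_nsmul _ _ (δ * τ) fun i hi =>
      hterm i (Finset.mem_compl.1 hi) t ht).trans ?_)
    rw [nsmul_eq_mul]
    gcongr
    exact Finset.card_le_univ _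

end Truncation

/-! ### The choice of the truncation radius -/

section Constants

theorem sq_mul_exp_neg_le_one {x : ℝ} (hx : 0 ≤ x) : x ^ 2 * Real.exp (-x) ≤ 1 := by
  have h1 := Real.quadratic_le_exp_of_nonneg (div_nonneg hx zero_le_two)
  have h2 : x ≤ Real.exp (x / 2) := by nlinarith [sq_nonneg (x - 2)]
  have h3 : x ^ 2 ≤ Real.exp x := by
    calc x ^ 2 ≤ Real.exp (x / 2) ^ 2 := by gcongr
      _ = Real.exp x := by rw [← Real.exp_nat_mul]; congr 1; push_cast; ring
  rw [Real.exp_neg, ← div_eq_mul_inv]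
  exact (div_le_one (Real.exp_pos x)).2 h3

/-- With a runtime of at least `a log^{1+α}(N/ε)`, a large rate of exponential decay beats all the
powers of `N/ε` and of the runtime. -/
theorem exists_rate_le {c γ ν : ℝ} (hc : 0 < c) (hγ : 0 < γ) (hν : 0 < ν) {α a : ℝ}
    (hα : 0 ≤ α) (ha : 0 < a) : ∃ χ₀ : ℝ, 1 ≤ χ₀ ∧ ∀ χ, χ₀ ≤ χ → ∀ (N : ℕ) (τ ε : ℝ), 0 < N →
      0 < τ → 0 < ε → ε ≤ 1 → a * Real.log (N / ε) ^ (1 + α) ≤ τ →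
      c * (N : ℝ) ^ 2 * τ ^ 2 * Real.exp ((γ - ν * χ / 2) * τ) ≤ ε / N := by
  -- `κ ^ 2` has to dominate `c e³`, where `e³` comes from `log (N / ε) ≤ 1 + τ / a`
  set κ := 1 + c * Real.exp 3 with hκ
  refine ⟨1 + 2 / ν * (γ + 3 / a + κ), ?_, ?_⟩
  · have : 0 ≤ 2 / ν * (γ + 3 / a + κ) := by positivity
    linarith
  intro χ hχ N τ ε hN hτ hε hε1 hlog
  have hN1 : (1 : ℝ) ≤ N := by exact_mod_cast hN
  have hNε : 1 ≤ (N : ℝ) / ε := (one_le_div hε).2 (hε1.trans hN1)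
  set ℓ := Real.log (N / ε) with hℓ
  have hℓ0 : 0 ≤ ℓ := Real.log_nonneg hNε
  have hexp : Real.exp ℓ = N / ε := Real.exp_log (by positivity)
  -- if `log (N / ε) < 1`, then the hypothesis on `τ` says little, but then the `1` suffices
  have hℓτ : ℓ ≤ 1 + τ / a := by
    rcases le_total ℓ 1 with h | h
    · have : 0 ≤ τ / a := by positivity
      linarith
    · have h1 : ℓ ≤ ℓ ^ (1 + α) := by
        simpa using Real.rpow_le_rpow_of_exponent_le h (show 1 ≤ 1 + α by linarith)
      have h2 : ℓ ^ (1 + α) ≤ τ / a := by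
        rw [le_div_iff₀ ha, mul_comm]
        exact hlog
      linarith
  have hrate : (γ - ν * χ / 2) * τ ≤ -(3 / a) * τ + -(κ * τ) := by
    have h1 : ν * (2 / ν * (γ + 3 / a + κ)) = 2 * (γ + 3 / a + κ) := by field_simp
    have h2 : ν * (1 + 2 / ν * (γ + 3 / a + κ)) ≤ ν * χ := by gcongr
    have h3 : γ - ν * χ / 2 ≤ -(3 / a) - κ := by linarith
    nlinarith
  have hκ1 : 1 ≤ κ := by
    have : 0 ≤ c * Real.exp 3 := by positivity
    linarith
  have h1 : c * Real.exp 3 * (τ ^ 2 * Real.exp (-(κ * τ))) ≤ 1 := by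
    have h2 := sq_mul_exp_neg_le_one (x := κ * τ) (by positivity)
    calc c * Real.exp 3 * (τ ^ 2 * Real.exp (-(κ * τ)))
        ≤ κ ^ 2 * (τ ^ 2 * Real.exp (-(κ * τ))) := by
          gcongr
          nlinarith
      _ = (κ * τ) ^ 2 * Real.exp (-(κ * τ)) := by ring
      _ ≤ 1 := h2
  have h2 : (N : ℝ) ^ 3 / ε ≤ Real.exp 3 * Real.exp (3 / a * τ) := by
    calc (N : ℝ) ^ 3 / ε ≤ (N / ε) ^ 3 := by
          rw [div_pow]
          gcongr
          nlinarith [mul_nonneg hε.le hε.le]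
      _ = Real.exp (3 * ℓ) := by rw [← hexp, ← Real.exp_nat_mul]; norm_num
      _ ≤ Real.exp 3 * Real.exp (3 / a * τ) := by
          rw [← Real.exp_add]
          gcongr
          have : 3 / a * τ = 3 * (τ / a) := by ring
          linarith
  rw [le_div_iff₀ (by positivity)]
  calc c * (N : ℝ) ^ 2 * τ ^ 2 * Real.exp ((γ - ν * χ / 2) * τ) * N
      ≤ c * (N : ℝ) ^ 2 * τ ^ 2 * (Real.exp (-(3 / a) * τ) * Real.exp (-(κ * τ))) * N := by
        rw [← Real.exp_add]
        gcongr
    _ = ε * (c * ((N : ℝ) ^ 3 / ε) * (τ ^ 2 * Real.exp (-(κ * τ))) * Real.exp (-(3 / a) * τ)) := by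
        field_simp
    _ ≤ ε * (c * (Real.exp 3 * Real.exp (3 / a * τ)) * (τ ^ 2 * Real.exp (-(κ * τ))) *
          Real.exp (-(3 / a) * τ)) := by gcongr
    _ = ε * (c * Real.exp 3 * (τ ^ 2 * Real.exp (-(κ * τ)))) := by
        have : Real.exp (3 / a * τ) * Real.exp (-(3 / a) * τ) = 1 := by
          rw [← Real.exp_add]; simp
        linear_combination ε * c * Real.exp 3 * (τ ^ 2 * Real.exp (-(κ * τ))) * this
    _ ≤ ε * 1 := by gcongr
    _ = ε := mul_one ε

end Constants

end SpinLattice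

open SpinLattice in
theorem theorem2 {V : Type*} [DecidableEq V] (𝒢 : SimpleGraph V) (h𝒢 : 𝒢.Connected)
    (Δ : ℕ) (hΔ : ∀ v, (𝒢.neighborSet v).encard ≤ Δ)
    (R M : ℕ) (J : ℝ) (hJ : 0 ≤ J) :
    -- Lieb-Robinson constants, depending on the lattice and the interaction strength only
    ∃ c₀ γ ν : ℝ, 0 < c₀ ∧ 0 < γ ∧ 0 < ν ∧ LiebRobinsonBound 𝒢 R M J c₀ γ ν ∧
    -- at most `C * N` terms, at most `K` sites on which the path changes
    ∀ (C : ℝ) (K : ℕ), ∃ c : ℝ, c₀ ≤ c ∧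
      (∃ χ₀ : ℝ, 0 < χ₀ ∧ ∀ χ : ℝ, χ₀ ≤ χ →
        ∀ (N : ℕ) (τ : ℝ), 0 < N → 0 < τ →
        ∀ (q : ℕ) (Λ : Finset V) (ι : Type) [Fintype ι] (G : ι → ℝ → Op Λ q) (D : Finset Λ)
          (φ : State Λ q) (ψ ψ' : ℝ → State Λ q),
          IsLocallyChangingPath 𝒢 R M J G D → (Fintype.card ι : ℝ) ≤ C * N → D.card ≤ K →
          IsGroundState (total G 0) φ →
          IsAdiabaticEvolution τ (truncation 𝒢 G D (χ * τ)) φ ψ →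
          IsAdiabaticEvolution τ (total G) φ ψ' →
          ‖ψ' τ - ψ τ‖ ≤ c * (N : ℝ) ^ 2 * τ ^ 2 * Real.exp ((γ - ν * χ / 2) * τ)) ∧
      (∀ α : ℝ, 0 ≤ α → ∀ a : ℝ, 0 < a → ∃ χ₀ : ℝ, 0 < χ₀ ∧ ∀ χ : ℝ, χ₀ ≤ χ →
        ∀ (N : ℕ) (τ ε : ℝ), 0 < N → 0 < τ → 0 < ε → ε ≤ 1 →
        a * Real.log (N / ε) ^ (1 + α) ≤ τ →
        ∀ (q : ℕ) (Λ : Finset V) (ι : Type) [Fintype ι] (G : ι → ℝ → Op Λ q) (D : Finset Λ)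
          (φ : State Λ q) (ψ ψ' : ℝ → State Λ q),
          IsLocallyChangingPath 𝒢 R M J G D → (Fintype.card ι : ℝ) ≤ C * N → D.card ≤ K →
          IsGroundState (total G 0) φ →
          IsAdiabaticEvolution τ (truncation 𝒢 G D (χ * τ)) φ ψ →
          IsAdiabaticEvolution τ (total G) φ ψ' →
          ‖ψ' τ - ψ τ‖ ≤ ε / N) := by
  have hexp : (0 : ℝ) < Real.exp R := Real.exp_pos _
  have hc₀ : 0 < lrConstant R M J := by unfold lrConstant; positivity
  have hγ : 0 < lrVelocity Δ R M J := zero_lt_one.trans_le (lrVelocity_ge_one hJ)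
  have hLR := liebRobinsonBound (R := R) (M := M) h𝒢 hΔ hJ
  refine ⟨lrConstant R M J, lrVelocity Δ R M J, 1, hc₀, hγ, one_pos, hLR, fun C K => ?_⟩
  set c₀ := lrConstant R M J
  set γ := lrVelocity Δ R M J
  set c := c₀ + |C| * (c₀ * K * (K * M * (2 * J)) * J) with hc
  have hcc₀ : c₀ ≤ c := by
    have : 0 ≤ |C| * (c₀ * K * (K * M * (2 * J)) * J) := by positivity
    linarith
  have hmain : ∀ χ : ℝ, 1 ≤ χ → ∀ (N : ℕ) (τ : ℝ), 0 < N → 0 < τ →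
      ∀ (q : ℕ) (Λ : Finset V) (ι : Type) [Fintype ι] (G : ι → ℝ → Op Λ q) (D : Finset Λ)
        (φ : State Λ q) (ψ ψ' : ℝ → State Λ q),
        IsLocallyChangingPath 𝒢 R M J G D → (Fintype.card ι : ℝ) ≤ C * N → D.card ≤ K →
        IsGroundState (total G 0) φ →
        IsAdiabaticEvolution τ (truncation 𝒢 G D (χ * τ)) φ ψ →
        IsAdiabaticEvolution τ (total G) φ ψ' →
        ‖ψ' τ - ψ τ‖ ≤ c * (N : ℝ) ^ 2 * τ ^ 2 * Real.exp ((γ - 1 * χ / 2) * τ) := by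
    intro χ hχ N τ hN hτ q Λ ι _ G D φ ψ ψ' hG hcard hD hφ hψ hψ'
    refine (hG.norm_sub_le hLR hJ hc₀.le hγ.le hτ (by positivity) hφ hψ hψ').trans ?_
    have hN1 : (1 : ℝ) ≤ N := by exact_mod_cast hN
    have hDK : (D.card : ℝ) ≤ K := by exact_mod_cast hD
    have hcard' : (Fintype.card ι : ℝ) ≤ |C| * N ^ 2 := by
      refine hcard.trans (mul_le_mul (le_abs_self C) ?_ (by positivity) (abs_nonneg C))
      nlinarith
    have hexp : γ * τ - 1 * (χ * τ) ≤ (γ - 1 * χ / 2) * τ := by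
      nlinarith [mul_pos (zero_lt_one.trans_le hχ) hτ]
    calc _ ≤ (|C| * N ^ 2) * (c₀ * K * (K * M * (2 * J)) * J *
          Real.exp ((γ - 1 * χ / 2) * τ)) * τ ^ 2 := by gcongr
      _ = (|C| * (c₀ * K * (K * M * (2 * J)) * J)) * N ^ 2 * τ ^ 2 *
          Real.exp ((γ - 1 * χ / 2) * τ) := by ring
      _ ≤ _ := by
        gcongr
        exact le_add_of_nonneg_left hc₀.le
  refine ⟨c, hcc₀, ⟨1, one_pos, hmain⟩, fun α hα a ha => ?_⟩
  obtain ⟨χ₀, hχ₀, hrate⟩ := exists_rate_le (hc₀.trans_le hcc₀) hγ one_pos hα ha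
  refine ⟨χ₀, one_pos.trans_le hχ₀, fun χ hχ N τ ε hN hτ hε hε1 hlog => ?_⟩
  intro q Λ ι _ G D φ ψ ψ' hG hcard hD hφ hψ hψ'
  exact (hmain χ (hχ₀.trans hχ) N τ hN hτ q Λ ι G D φ ψ ψ' hG hcard hD hφ hψ hψ').trans
    (hrate χ hχ N τ ε hN hτ hε hε1 hlog)
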